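/- Let $P$ be a hyperbolic $n$-manifold with right-angled corners, i.e. a space locally isometric to $\{x_1\ge 0,\dots,x_n\ge 0\}\subset\mathbb H^n$ (hyperboloid model). It is stratified by codimension: a point has codimension $k$ if it lies on exactly $k$ of the walls $x_i=0$ in a chart. The faces of codimension $k$ are the closures of the connected components of the codimension-$k$ stratum; $\operatorname{Fac}(P)$ denotes the set of facets (codimension $1$). Assume that the facets are embedded: no facet is adjacent to itself along a ridge (codimension $2$). Let $V$ be a finite-dimensional vector space over $\mathbb Z_2$ and let $\lambda\colon\operatorname{Fac}(P)\to V$ be a proper coloring, meaning that the colors of the distinct facets passing through any common point are linearly independent. Let $M(P,\lambda)$ be the real toric manifold obtained from copies $P_v$ $(v\in V)$ of $P$ by gluing $P_v$ to $P_{v+\lambda(G)}$ along $G$ by the identity, for all $v\in V$ and $G\in\operatorname{Fac}(P)$; write $[v,x]$ for the image of the point $x$ of $P_v$. Let $F$ be a face of $P$, of dimension $m$. Let $\operatorname{supp}(F)$ be the set of facets of $P$ containing $F$, let $\operatorname{adj}(F)$ be the set of facets of $P$ that intersect the boundary of $F$ but not its interior, and let $M_F\subset M(P,\lambda)$ be the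 preimage of $F$ under the projection $M(P,\lambda)\to P$, $[v,x]\mapsto x$. Then: 1. $F$ is a hyperbolic $m$-manifold with right-angled corners and embedded facets. Each facet of $F$ is contained in exactly one element of $\operatorname{adj}(F)$, and the resulting natural map $\operatorname{Fac}(F)\to\operatorname{adj}(F)$ is surjective. 2. The composition $$\lambda_F\colon \operatorname{Fac}(F)\twoheadrightarrow\operatorname{adj}(F)\hookrightarrow\operatorname{Fac}(P)\xrightarrow{\ \lambda\ }V\twoheadrightarrow V/\langle\lambda(i)\mid i\in\operatorname{supp}(F)\rangle$$ is a proper coloring of $F$. 3. $M_F=M(F,\lambda_F)$: the rule $[\bar v,x]\mapsto[v,x]$ $(x\in F,\ v\in V)$ is a well-defined homeomorphism $M(F,\lambda_F)\to M_F$, and it is a local isometry for the gluing metric of $M(F,\lambda_F)$ and the restriction to $M_F$ of the gluing metric of $M(P,\lambda)$. -/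

import Mathlib

open Set Topology
open scoped ENNReal

namespace RightAngled

/-! ### The hyperbolic model -/

/-- Hyperbolic distance in `ℍⁿ`. Points of the upper sheet
`x₀² = 1 + x₁² + ⋯ + xₙ²`, `x₀ > 0` of the hyperboloid are given by their coordinates
`x₁, …, xₙ` (so `x₀ = √(1 + ∑ xᵢ²)`), and `cosh d(x, y) = x₀ y₀ - ∑ xᵢ yᵢ`. -/
noncomputable def hypDist {n : ℕ} (x y : Fin n → ℝ) : ℝ :=
  Real.arcosh (√(1 + ∑ i, x i ^ 2) * √(1 + ∑ i, y i ^ 2) - ∑ i, x i * y i)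

/-- The right-angled corner in `ℍⁿ`: the intersection of the `n` half-spaces `xᵢ ≥ 0`, whose
bounding hyperplanes `xᵢ = 0` are pairwise orthogonal. Every germ of a right-angled polytope
(at a point of any codimension) occurs at some point of it. -/
def corner (n : ℕ) : Set (Fin n → ℝ) := {y | ∀ i, 0 ≤ y i}

/-- A chart on a metric space `X`: an isometry from the open set `U` onto a relatively open
subset of the right-angled corner in `ℍⁿ`. -/
structure IsCornerChart {X : Type*} [MetricSpace X] (n : ℕ) (U : Set X)
    (φ : X → Fin n → ℝ) : Prop where
  isOpen : IsOpen U
  isometry : ∀ x ∈ U, ∀ y ∈ U, dist x y = hypDist (φ x) (φ y)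
  image : ∃ O : Set (Fin n → ℝ), IsOpen O ∧ φ '' U = O ∩ corner n

/-- `X` is a hyperbolic `n`-manifold with right-angled corners: it is locally isometric to the
right-angled corner in `ℍⁿ`. The metric of `X` matters only locally (it need not be a path
metric). Neither compactness nor connectedness is required. -/
def IsRightAngledManifold (n : ℕ) (X : Type*) [MetricSpace X] : Prop :=
  ∀ x : X, ∃ (U : Set X) (φ : X → Fin n → ℝ), IsCornerChart n U φ ∧ x ∈ U

/-! ### Strata, faces and facets -/

/-- The stratum of codimension `k`: points lying on exactly `k` of the walls `xᵢ = 0` in a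
chart. -/
def stratum {X : Type*} [MetricSpace X] (n k : ℕ) : Set X :=
  {x | ∃ (U : Set X) (φ : X → Fin n → ℝ), IsCornerChart n U φ ∧ x ∈ U ∧
    {i | φ x i = 0}.ncard = k}

/-- A face of codimension `k`: the closure of a connected component of the stratum of
codimension `k`. -/
def IsFace {X : Type*} [MetricSpace X] (n k : ℕ) (F : Set X) : Prop :=
  ∃ x ∈ (stratum n k : Set X), F = closure (connectedComponentIn (stratum n k) x)

/-- The set `Fac(X)` of facets (faces of codimension `1`) of an `n`-dimensional `X`. -/
def Facet (n : ℕ) (X : Type*) [MetricSpace X] : Type _ := {G : Set X // IsFace n 1 G}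

/-- Facets are embedded: no facet is adjacent to itself along a ridge, i.e. the two sheets of the
boundary meeting at a point of codimension `2` belong to two different facets. -/
def EmbeddedFacets (n : ℕ) (X : Type*) [MetricSpace X] : Prop :=
  ∀ x ∈ (stratum n 2 : Set X), ∃ G H : Facet n X, G ≠ H ∧ x ∈ G.1 ∧ x ∈ H.1

/-- The interior of an `n`-dimensional right-angled manifold (as a manifold with corners). -/
def interiorPoints (n : ℕ) (X : Type*) [MetricSpace X] : Set X := stratum n 0

/-- The boundary of an `n`-dimensional right-angled manifold (as a manifold with corners). -/
def boundaryPoints (n : ℕ) (X : Type*) [MetricSpace X] : Set X := (interiorPoints n X)ᶜ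

/-- `supp(F)`: the facets of `X` containing `F`. -/
def supp {X : Type*} [MetricSpace X] (n : ℕ) (F : Set X) : Set (Facet n X) :=
  {H | F ⊆ H.1}

/-- `adj(F)`: the facets of `X` that intersect the boundary of `F` but not its interior, where
`F` is a face of dimension `m` of the `n`-dimensional manifold `X`. -/
def adj {X : Type*} [MetricSpace X] (n m : ℕ) (F : Set X) : Set (Facet n X) :=
  {H | (∃ x ∈ boundaryPoints m F, (x : X) ∈ H.1) ∧ ∀ x ∈ interiorPoints m F, (x : X) ∉ H.1}

/-! ### Colorings and real toric manifolds -/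

/-- `lam` is a (proper) coloring: the colors of facets having a common point are linearly
independent. -/
def IsColoring {V : Type*} [AddCommGroup V] [Module (ZMod 2) V] (n : ℕ) (X : Type*)
    [MetricSpace X] (lam : Facet n X → V) : Prop :=
  ∀ x : X, LinearIndependent (ZMod 2) (fun G : {G : Facet n X // x ∈ G.1} => lam G.1)

/-- The elementary gluings between the copies `X_v = {v} × X`, `v ∈ V`: for each facet `G`, the
copies `X_v` and `X_{v + lam G}` are glued along `G` by the identity. -/
inductive Glue {V : Type*} [AddCommGroup V] (n : ℕ) (X : Type*) [MetricSpace X]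
    (lam : Facet n X → V) : (Σ _ : V, X) → (Σ _ : V, X) → Prop
  | glue (v : V) (G : Facet n X) (x : X) (hx : x ∈ G.1) : Glue n X lam ⟨v, x⟩ ⟨v + lam G, x⟩

/-- The space `M(X, lam)`: the disjoint union of copies of `X` indexed by `V`, modulo the
equivalence relation generated by the gluings. -/
def RealToric {V : Type*} [AddCommGroup V] (n : ℕ) (X : Type*) [MetricSpace X]
    (lam : Facet n X → V) : Type _ :=
  Quot (Glue n X lam)

namespace RealToric

/-- The quotient topology. -/
instance {V : Type*} [AddCommGroup V] (n : ℕ) (X : Type*) [MetricSpace X]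
    (lam : Facet n X → V) : TopologicalSpace (RealToric n X lam) :=
  inferInstanceAs (TopologicalSpace (Quot (Glue n X lam)))

variable {V : Type*} [AddCommGroup V] {n : ℕ} {X : Type*} [MetricSpace X] {lam : Facet n X → V}

/-- The point `x` of the copy `X_v`. -/
def mk (lam : Facet n X → V) (v : V) (x : X) : RealToric n X lam := Quot.mk _ ⟨v, x⟩

/-- The natural projection `M(X, lam) → X`. -/
def proj : RealToric n X lam → X :=
  Quot.lift (fun p => p.2) (by rintro _ _ ⟨v, G, x, hx⟩; rfl)

/-- `HasChain p q l`: one can go from `p` to `q` in finitely many steps, each of them inside one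
copy of `X`, the lengths of the steps adding up to `l`. -/
inductive HasChain (p : RealToric n X lam) : RealToric n X lam → ℝ≥0∞ → Prop
  | refl : HasChain p p 0
  | step (v : V) (x y : X) (l : ℝ≥0∞) :
      HasChain p (mk lam v x) l → HasChain p (mk lam v y) (l + edist x y)

/-- The quotient (gluing) distance on `M(X, lam)`: the infimum of the lengths of chains. It is
infinite between points that are not joined by a chain. Near each point it is the hyperbolic
distance obtained by gluing the hyperbolic metrics of the copies of `X`. -/
noncomputable def glueDist (p q : RealToric n X lam) : ℝ≥0∞ := sInf {l | HasChain p q l}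

end RealToric

/-- The induced coloring of a face `F` of `X`: the composition
`Fac(F) → adj(F) ↪ Fac(X) → V → V / ⟨lam i | i ∈ supp(F)⟩`, with first arrow `π` and third
arrow `lam`. -/
def inducedColoring {V : Type*} [AddCommGroup V] [Module (ZMod 2) V] {n m : ℕ} {X : Type*}
    [MetricSpace X] (F : Set X) (lam : Facet n X → V) (π : Facet m F → adj n m F) :
    Facet m F → V ⧸ Submodule.span (ZMod 2) (lam '' supp n F) :=
  fun G => (Submodule.span (ZMod 2) (lam '' supp n F)).mkQ (lam (π G).1)

end RightAngled

/-! Everything reduces to linear algebra in one chart, once two facts are known. First, the number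
of walls through a point is intrinsic (`IsCornerChart.ncard_zeroSet_eq`): `cosh` of the distance is
the Lorentz product, so an isometry preserves linear relations between points of the hyperboloid,
and the walls through `x` cut out the span of the points whose geodesic to `x` continues beyond `x`.
Second, embeddedness makes distinct walls at a point belong to distinct facets
(`IsFacetLabel.injOn`). So inside a small box a face `F` is a single coordinate subspace, given by
the walls `S` whose facets contain `F` (`IsFace.exists_isFaceBox`).

Forgetting the coordinates in `S` gives charts of `F`, and the facets of `F` at a point correspond
to the remaining walls there. This yields the map to `adj(F)`, its surjectivity and its injectivity
on the facets through one point. Hence the colors at a point of `F` split into those of `supp(F)`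
and those of distinct other facets, so the latter stay independent in the quotient.

Points of the glued space are identified exactly when their copies differ by the span of the colors
of facets through the common point (`RealToric.mk_eq_mk_iff`). Comparing these spans on both sides
makes `[v̄, x] ↦ [v, x]` injective, and it is closed because `F` is. For distances, gluing more
copies could only create shortcuts. Orthogonal projection to the walls in `S` is 1-Lipschitz and
keeps every point on its walls, so it pushes short chains into `M_F` without lengthening them
(`IsFace.exists_retraction`, `IsFace.exists_glueDist_eq`). -/

namespace RightAngled


/-! ### The Lorentz product -/

section Lorentz

variable {n : ℕ}

/-- The time coordinate of the point of the hyperboloid with space coordinates `x`. -/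
noncomputable def timeCoord (x : Fin n → ℝ) : ℝ := √(1 + ∑ i, x i ^ 2)

/-- The negative of the Lorentz product of two points of the hyperboloid. -/
noncomputable def lorentz (x y : Fin n → ℝ) : ℝ := timeCoord x * timeCoord y - ∑ i, x i * y i

theorem hypDist_eq_arcosh (x y : Fin n → ℝ) : hypDist x y = Real.arcosh (lorentz x y) := rfl

theorem timeCoord_sq (x : Fin n → ℝ) : timeCoord x ^ 2 = 1 + ∑ i, x i ^ 2 :=
  Real.sq_sqrt (by positivity)

theorem timeCoord_pos (x : Fin n → ℝ) : 0 < timeCoord x := Real.sqrt_pos.2 (by positivity)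

theorem sum_mul_sq_le (x y : Fin n → ℝ) :
    (∑ i, x i * y i) ^ 2 ≤ (∑ i, x i ^ 2) * ∑ i, y i ^ 2 :=
  Finset.sum_mul_sq_le_sq_mul_sq _ _ _

theorem sum_sub_sq (x y : Fin n → ℝ) :
    ∑ i, (x i - y i) ^ 2 = (∑ i, x i ^ 2) + (∑ i, y i ^ 2) - 2 * ∑ i, x i * y i := by
  rw [Finset.mul_sum, ← Finset.sum_add_distrib, ← Finset.sum_sub_distrib]
  exact Finset.sum_congr rfl fun i _ => by ring

/-- Reversed Cauchy–Schwarz inequality for timelike vectors. It makes `arcosh` invertible here, so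
distances and Lorentz products carry the same information. -/
theorem one_le_lorentz (x y : Fin n → ℝ) : 1 ≤ lorentz x y := by
  have h1 := sum_mul_sq_le x y
  have h2 := sum_sub_sq x y
  have h3 : 0 ≤ ∑ i, (x i - y i) ^ 2 := by positivity
  have : 1 + ∑ i, x i * y i ≤ timeCoord x * timeCoord y := by
    refine le_of_abs_le (abs_le_of_sq_le_sq ?_ (mul_pos (timeCoord_pos x) (timeCoord_pos y)).le)
    rw [mul_pow, timeCoord_sq, timeCoord_sq]
    nlinarith
  unfold lorentz
  linarith

theorem lorentz_self (x : Fin n → ℝ) : lorentz x x = 1 := by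
  have := timeCoord_sq x
  simp only [lorentz, ← sq]
  linarith

theorem hypDist_self (x : Fin n → ℝ) : hypDist x x = 0 := by
  rw [hypDist_eq_arcosh, lorentz_self, Real.arcosh_zero]

theorem cosh_hypDist (x y : Fin n → ℝ) : Real.cosh (hypDist x y) = lorentz x y := by
  rw [hypDist_eq_arcosh, Real.cosh_arcosh (one_le_lorentz x y)]

theorem hypDist_le_iff {m : ℕ} {x y : Fin n → ℝ} {z w : Fin m → ℝ} :
    hypDist x y ≤ hypDist z w ↔ lorentz x y ≤ lorentz z w :=
  Real.arcosh_le_arcosh (zero_lt_one.trans_le (one_le_lorentz _ _))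
    (zero_lt_one.trans_le (one_le_lorentz _ _))

theorem continuous_timeCoord : Continuous (timeCoord : (Fin n → ℝ) → ℝ) := by
  unfold timeCoord
  fun_prop

theorem continuous_hypDist_left (x : Fin n → ℝ) : Continuous fun y => hypDist y x := by
  refine Real.continuousOn_arcosh.comp_continuous (f := fun y => lorentz y x) ?_
    fun y => one_le_lorentz y x
  have := continuous_timeCoord (n := n)
  unfold lorentz
  fun_prop

/-- The hyperbolic distance controls the Euclidean one. -/
theorem sum_sub_sq_le (x y : Fin n → ℝ) :
    ∑ i, (x i - y i) ^ 2 ≤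
      (lorentz x y - 1) * (2 * timeCoord y * lorentz x y + timeCoord y) ^ 2 / 2 := by
  have hC := sum_mul_sq_le x y
  have hD := sum_sub_sq x y
  have hx := timeCoord_sq x
  have hy := timeCoord_sq y
  have px := timeCoord_pos x
  have py := timeCoord_pos y
  have h1 := one_le_lorentz x y
  have hsub : (∑ i, x i ^ 2 - ∑ i, y i ^ 2) ^ 2 ≤
      (∑ i, (x i - y i) ^ 2) * ∑ i, (x i + y i) ^ 2 := by
    have := Finset.sum_mul_sq_le_sq_mul_sq Finset.univ (fun i => x i - y i) (fun i => x i + y i)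
    rwa [show ∑ i, (x i - y i) * (x i + y i) = ∑ i, x i ^ 2 - ∑ i, y i ^ 2 by
      rw [← Finset.sum_sub_distrib]; exact Finset.sum_congr rfl fun i _ => by ring] at this
  have hadd : ∑ i, (x i + y i) ^ 2 =
      (∑ i, x i ^ 2) + (∑ i, y i ^ 2) + 2 * ∑ i, x i * y i := by
    rw [Finset.mul_sum, ← Finset.sum_add_distrib, ← Finset.sum_add_distrib]
    exact Finset.sum_congr rfl fun i _ => by ring
  have hL : lorentz x y = timeCoord x * timeCoord y - ∑ i, x i * y i := rfl
  have hX0 : 0 ≤ ∑ i, x i ^ 2 := by positivity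
  have hY0 : 0 ≤ ∑ i, y i ^ 2 := by positivity
  have hD0 : 0 ≤ ∑ i, (x i - y i) ^ 2 := by positivity
  generalize ∑ i, x i ^ 2 = X at *
  generalize ∑ i, y i ^ 2 = Y at *
  generalize ∑ i, x i * y i = C at *
  generalize ∑ i, (x i - y i) ^ 2 = D at *
  generalize ∑ i, (x i + y i) ^ 2 = A at *
  generalize timeCoord x = a at *
  generalize timeCoord y = b at *
  generalize lorentz x y = M at *
  -- Since `(a - b) * (a + b) = X - Y`, Cauchy–Schwarz bounds `(a - b)² (a + b)²` by `D * A`, and `a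
  -- * b ≥ 1 + C` gives `A ≤ (a + b)² - 4`.
  have e : D * 4 ≤ (D - (a - b) ^ 2) * (a + b) ^ 2 := by
    have e1 : D * A ≤ D * ((a + b) ^ 2 - 4) := mul_le_mul_of_nonneg_left (by nlinarith) hD0
    have e2 : (a - b) ^ 2 * (a + b) ^ 2 = (X - Y) ^ 2 := by
      rw [← mul_pow, show (a - b) * (a + b) = a ^ 2 - b ^ 2 by ring, hx, hy]; ring
    nlinarith
  have e3 : D - (a - b) ^ 2 = 2 * (M - 1) := by nlinarith
  -- This bounds the time coordinate of `x` by data of the base point `y` and the distance alone, so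
  -- the final estimate tends to zero with the distance.
  have e4 : a ≤ 2 * b * M := by
    have : 2 * b * C ≤ a * (1 + 2 * Y) := by
      refine le_of_abs_le (abs_le_of_sq_le_sq ?_ (by positivity))
      have : (2 * b * C) ^ 2 = 4 * (1 + Y) * C ^ 2 := by rw [mul_pow, mul_pow, hy]; ring
      rw [this, mul_pow, hx]
      have f1 : 4 * (1 + Y) * C ^ 2 ≤ 4 * (1 + Y) * (X * Y) :=
        mul_le_mul_of_nonneg_left hC (by positivity)
      nlinarith [mul_nonneg hX0 hY0]
    rw [hL]
    nlinarith
  rw [e3] at e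
  have e5 : (M - 1) * (a + b) ^ 2 ≤ (M - 1) * (2 * b * M + b) ^ 2 :=
    mul_le_mul_of_nonneg_left (pow_le_pow_left₀ (by positivity) (by linarith) 2) (by linarith)
  linarith

end Lorentz

/-! ### Charts as homeomorphisms -/

namespace IsCornerChart

variable {X : Type*} [MetricSpace X] {n : ℕ} {U V : Set X} {φ ψ : X → Fin n → ℝ} {x y : X}

theorem injOn (h : IsCornerChart n U φ) : InjOn φ U := fun x hx y hy hxy => by
  rw [← dist_eq_zero, h.isometry x hx y hy, hxy, hypDist_self]

theorem nonneg (h : IsCornerChart n U φ) (hx : x ∈ U) (i : Fin n) : 0 ≤ φ x i := by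
  obtain ⟨O, -, hO⟩ := h.image
  exact (hO ▸ mem_image_of_mem φ hx : φ x ∈ O ∩ corner n).2 i

theorem cosh_dist (h : IsCornerChart n U φ) (hx : x ∈ U) (hy : y ∈ U) :
    Real.cosh (dist x y) = lorentz (φ x) (φ y) := by
  rw [h.isometry x hx y hy, cosh_hypDist]

theorem continuousAt (h : IsCornerChart n U φ) (hx : x ∈ U) : ContinuousAt φ x := by
  have hlim : Filter.Tendsto (fun y => Real.cosh (dist y x)) (𝓝 x) (𝓝 1) := by
    have : Continuous fun y => Real.cosh (dist y x) := by fun_prop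
    simpa using this.tendsto x
  have hb : Filter.Tendsto (fun y => (Real.cosh (dist y x) - 1) *
      (2 * timeCoord (φ x) * Real.cosh (dist y x) + timeCoord (φ x)) ^ 2 / 2) (𝓝 x) (𝓝 0) := by
    have := ((hlim.sub_const 1).mul (((hlim.const_mul (2 * timeCoord (φ x))).add_const
      (timeCoord (φ x))).pow 2)).div_const 2
    simpa using this
  refine tendsto_pi_nhds.2 fun i => ?_
  have hsq : Filter.Tendsto (fun y => (φ y i - φ x i) ^ 2) (𝓝 x) (𝓝 0) := by
    refine squeeze_zero' (Filter.Eventually.of_forall fun y => sq_nonneg _) ?_ hb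
    filter_upwards [h.isOpen.mem_nhds hx] with y hy
    rw [h.cosh_dist hy hx]
    exact (Finset.single_le_sum (f := fun i => (φ y i - φ x i) ^ 2) (fun i _ => sq_nonneg _)
      (Finset.mem_univ i)).trans (sum_sub_sq_le (φ y) (φ x))
  have habs := (Real.continuous_sqrt.tendsto 0).comp hsq
  simp only [Function.comp_def, Real.sqrt_sq_eq_abs, Real.sqrt_zero] at habs
  exact tendsto_sub_nhds_zero_iff.1 ((tendsto_zero_iff_abs_tendsto_zero _).2 habs)

theorem continuousOn (h : IsCornerChart n U φ) : ContinuousOn φ U :=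
  fun _ hx => (h.continuousAt hx).continuousWithinAt

/-- Points of the corner close to `φ x` come from points close to `x`. -/
theorem eventually_exists (h : IsCornerChart n U φ) (hx : x ∈ U) (hV : V ∈ 𝓝 x) :
    ∀ᶠ z in 𝓝 (φ x), z ∈ corner n → ∃ y ∈ U ∩ V, φ y = z := by
  obtain ⟨O, hO, hUO⟩ := h.image
  have hxO : φ x ∈ O := (hUO ▸ mem_image_of_mem φ hx : φ x ∈ O ∩ corner n).1
  obtain ⟨ε, hε, hball⟩ := Metric.mem_nhds_iff.1 hV
  have hd := (continuous_hypDist_left (φ x)).tendsto (φ x)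
  rw [hypDist_self] at hd
  filter_upwards [hO.mem_nhds hxO, hd.eventually_lt_const hε] with z hzO hz hzc
  obtain ⟨y, hy, rfl⟩ : z ∈ φ '' U := hUO ▸ ⟨hzO, hzc⟩
  exact ⟨y, ⟨hy, hball (by rwa [Metric.mem_ball, h.isometry y hy x hx])⟩, rfl⟩

theorem inter_isOpen (h : IsCornerChart n U φ) (hV : IsOpen V) : IsCornerChart n (U ∩ V) φ where
  isOpen := h.isOpen.inter hV
  isometry x hx y hy := h.isometry x hx.1 y hy.1
  image := by
    -- The interior of the set of `z` that are either outside the corner or hit by `U ∩ V`;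
    -- `eventually_exists` says that it contains the whole image.
    refine ⟨interior {z | z ∈ corner n → ∃ y ∈ U ∩ V, φ y = z}, isOpen_interior, ?_⟩
    refine Subset.antisymm ?_ fun z hz => interior_subset hz.1 hz.2
    rintro _ ⟨y, hy, rfl⟩
    exact ⟨mem_interior_iff_mem_nhds.2 (h.eventually_exists hy.1 (hV.mem_nhds hy.2)),
      h.nonneg hy.1⟩

/-- Makes the chart a homeomorphism onto its image, so that connectedness of boxes can be
transported to `X`. -/
theorem continuousOn_invFunOn [Nonempty X] (h : IsCornerChart n U φ) :
    ContinuousOn (Function.invFunOn φ U) (φ '' U) := by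
  rintro _ ⟨x, hx, rfl⟩
  rw [ContinuousWithinAt, h.injOn.leftInvOn_invFunOn hx]
  refine Filter.tendsto_def.2 fun W hW => mem_nhdsWithin_iff_eventually.2 ?_
  filter_upwards [h.eventually_exists hx hW] with z hz hzU
  obtain ⟨w, hw, rfl⟩ := hzU
  obtain ⟨y, hy, hyz⟩ := hz (h.nonneg hw)
  rw [h.injOn hy.1 hw hyz] at hy
  rw [mem_preimage, h.injOn.leftInvOn_invFunOn hw]
  exact hy.2

end IsCornerChart

/-! ### The codimension of a point does not depend on the chart -/

/-- The coordinates vanishing at the point `a` of the corner. -/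
def zeroSet {n : ℕ} (a : Fin n → ℝ) : Set (Fin n) := {i | a i = 0}

theorem mem_zeroSet {n : ℕ} {a : Fin n → ℝ} {i : Fin n} : i ∈ zeroSet a ↔ a i = 0 := Iff.rfl

section Codimension

variable {n : ℕ}

/-- The point of the hyperboloid with space coordinates `x`. -/
noncomputable def hyperboloid (x : Fin n → ℝ) : ℝ × (Fin n → ℝ) := (timeCoord x, x)

/-- The Lorentz product with a fixed vector, with the sign such that it is `lorentz` on
the hyperboloid. -/
noncomputable def lorentzForm (Y : ℝ × (Fin n → ℝ)) : ℝ × (Fin n → ℝ) →ₗ[ℝ] ℝ where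
  toFun X := X.1 * Y.1 - ∑ i, X.2 i * Y.2 i
  map_add' X X' := by
    simp only [Prod.fst_add, Prod.snd_add, Pi.add_apply, add_mul, Finset.sum_add_distrib]
    ring
  map_smul' c X := by
    simp only [Prod.smul_fst, Prod.smul_snd, Pi.smul_apply, smul_eq_mul, RingHom.id_apply,
      mul_sub, Finset.mul_sum, mul_assoc]

theorem lorentzForm_hyperboloid (x y : Fin n → ℝ) :
    lorentzForm (hyperboloid y) (hyperboloid x) = lorentz x y := rfl

theorem lorentzForm_comm (X Y : ℝ × (Fin n → ℝ)) : lorentzForm X Y = lorentzForm Y X := by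
  simp only [lorentzForm, LinearMap.coe_mk, AddHom.coe_mk, mul_comm]

theorem eq_zero_of_lorentzForm_eq_zero {X : ℝ × (Fin n → ℝ)} (h : ∀ Y, lorentzForm X Y = 0) :
    X = 0 := by
  -- Flipping the space part turns the Lorentz form into the Euclidean square norm.
  have h1 := h (X.1, -X.2)
  simp only [lorentzForm, LinearMap.coe_mk, AddHom.coe_mk, Pi.neg_apply, neg_mul,
    Finset.sum_neg_distrib, sub_neg_eq_add, ← sq] at h1
  have h2 : 0 ≤ ∑ i, X.2 i ^ 2 := by positivity
  have h3 : X.1 = 0 := by nlinarith [sq_nonneg X.1]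
  have h4 : ∑ i, X.2 i ^ 2 = 0 := by nlinarith [sq_nonneg X.1]
  refine Prod.ext h3 (funext fun i => ?_)
  have := (Finset.sum_eq_zero_iff_of_nonneg fun i _ => sq_nonneg (X.2 i)).1 h4 i
    (Finset.mem_univ i)
  exact pow_eq_zero_iff two_ne_zero |>.1 this

/-- Radial projection of a vector to the hyperboloid, in space coordinates. -/
noncomputable def radial (Y : ℝ × (Fin n → ℝ)) : Fin n → ℝ :=
  (√(Y.1 ^ 2 - ∑ i, Y.2 i ^ 2))⁻¹ • Y.2

theorem smul_hyperboloid_radial {Y : ℝ × (Fin n → ℝ)} (h0 : 0 < Y.1)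
    (h : 0 < Y.1 ^ 2 - ∑ i, Y.2 i ^ 2) :
    √(Y.1 ^ 2 - ∑ i, Y.2 i ^ 2) • hyperboloid (radial Y) = Y := by
  set s := √(Y.1 ^ 2 - ∑ i, Y.2 i ^ 2) with hs
  have hs0 : 0 < s := Real.sqrt_pos.2 h
  have hs2 : s ^ 2 = Y.1 ^ 2 - ∑ i, Y.2 i ^ 2 := Real.sq_sqrt h.le
  refine Prod.ext ?_ ?_
  · have : timeCoord (radial Y) = s⁻¹ * Y.1 := by
      unfold timeCoord
      rw [Real.sqrt_eq_iff_mul_self_eq (by positivity) (by positivity)]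
      simp only [radial, ← hs, Pi.smul_apply, smul_eq_mul, mul_pow, ← Finset.mul_sum]
      field_simp
      rw [hs2]
      ring
    simp only [hyperboloid, Prod.smul_fst, smul_eq_mul, this]
    field_simp
  · simp only [hyperboloid, Prod.smul_snd, radial, ← hs]
    rw [smul_inv_smul₀ hs0.ne']

theorem radial_hyperboloid (x : Fin n → ℝ) : radial (hyperboloid x) = x := by
  have := timeCoord_sq x
  simp [radial, hyperboloid, this]

theorem continuousAt_radial (x : Fin n → ℝ) : ContinuousAt radial (hyperboloid x) := by
  have h1 : Continuous fun Y : ℝ × (Fin n → ℝ) => √(Y.1 ^ 2 - ∑ i, Y.2 i ^ 2) := by fun_prop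
  refine ContinuousAt.smul (h1.continuousAt.inv₀ ?_) continuous_snd.continuousAt
  have := timeCoord_sq x
  simp [hyperboloid, this]

variable {X : Type*} [MetricSpace X] {U : Set X} {φ ψ : X → Fin n → ℝ} {x : X}

/-- Small displacements of `x` along a vector tangent to all walls through `x` stay in the
chart. -/
theorem IsCornerChart.exists_radial_eq (h : IsCornerChart n U φ) (hx : x ∈ U)
    {Y : ℝ × (Fin n → ℝ)} (hY : ∀ i ∈ zeroSet (φ x), Y.2 i = 0) :
    ∀ᶠ t : ℝ in 𝓝 0, ∃ y ∈ U, ∃ s : ℝ, 0 < s ∧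
      s • hyperboloid (φ y) = hyperboloid (φ x) + t • Y := by
  have hline : Filter.Tendsto (fun t : ℝ => hyperboloid (φ x) + t • Y) (𝓝 0)
      (𝓝 (hyperboloid (φ x))) := by
    have : Continuous fun t : ℝ => hyperboloid (φ x) + t • Y := by fun_prop
    simpa using this.tendsto 0
  have hpos1 : ∀ᶠ Z : ℝ × (Fin n → ℝ) in 𝓝 (hyperboloid (φ x)), 0 < Z.1 :=
    (continuous_fst.tendsto _).eventually_const_lt (timeCoord_pos (φ x))
  have hpos2 : ∀ᶠ Z : ℝ × (Fin n → ℝ) in 𝓝 (hyperboloid (φ x)),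
      0 < Z.1 ^ 2 - ∑ i, Z.2 i ^ 2 := by
    have hc : Continuous fun Z : ℝ × (Fin n → ℝ) => Z.1 ^ 2 - ∑ i, Z.2 i ^ 2 := by fun_prop
    refine (hc.tendsto _).eventually_const_lt ?_
    have := timeCoord_sq (φ x)
    simp [hyperboloid, this]
  have hpos3 : ∀ᶠ Z : ℝ × (Fin n → ℝ) in 𝓝 (hyperboloid (φ x)),
      ∀ i, i ∉ zeroSet (φ x) → 0 < Z.2 i := by
    refine Filter.eventually_all.2 fun i => ?_
    by_cases hi : i ∈ zeroSet (φ x)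
    · exact Filter.Eventually.of_forall fun _ h => absurd hi h
    · have : 0 < (hyperboloid (φ x)).2 i := lt_of_le_of_ne (h.nonneg hx i) (Ne.symm hi)
      have hc : Continuous fun Z : ℝ × (Fin n → ℝ) => Z.2 i := by fun_prop
      exact ((hc.tendsto _).eventually_const_lt this).mono fun _ h _ => h
  have hrad : Filter.Tendsto radial (𝓝 (hyperboloid (φ x))) (𝓝 (φ x)) := by
    simpa only [ContinuousAt, radial_hyperboloid] using continuousAt_radial (φ x)
  have hex := hrad.eventually (h.eventually_exists hx Filter.univ_mem)
  filter_upwards [hline.eventually hpos1, hline.eventually hpos2, hline.eventually hpos3,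
    hline.eventually hex] with t h1 h2 h3 h4
  obtain ⟨y, hy, hyr⟩ := h4 fun i => by
    refine mul_nonneg (inv_nonneg.2 (Real.sqrt_nonneg _)) ?_
    by_cases hi : i ∈ zeroSet (φ x)
    · have h0 : φ x i = 0 := hi
      simp [hyperboloid, h0, hY i hi]
    · exact (h3 i hi).le
  exact ⟨y, hy.1, _, Real.sqrt_pos.2 h2, by rw [hyr, smul_hyperboloid_radial h1 h2]⟩

/-- Every nonempty chart contains a point outside all walls. -/
theorem IsCornerChart.exists_zeroSet_eq_empty (h : IsCornerChart n U φ) (hx : x ∈ U) :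
    ∃ y ∈ U, zeroSet (φ y) = ∅ := by
  have hline : Filter.Tendsto (fun t : ℝ => φ x + fun _ => t) (𝓝[>] 0) (𝓝 (φ x)) := by
    have : Continuous fun t : ℝ => φ x + fun _ => t := by fun_prop
    refine Filter.Tendsto.mono_left ?_ nhdsWithin_le_nhds
    have h0 := this.tendsto 0
    rwa [show (φ x + fun _ => (0 : ℝ)) = φ x from add_zero _] at h0
  obtain ⟨t, ht, ht0⟩ := ((hline.eventually (h.eventually_exists hx Filter.univ_mem)).and
    self_mem_nhdsWithin).exists
  have hp : ∀ i, 0 < φ x i + t := fun i => add_pos_of_nonneg_of_pos (h.nonneg hx i) ht0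
  obtain ⟨y, hy, hyt⟩ := ht fun i => (hp i).le
  refine ⟨y, hy.1, eq_empty_of_forall_notMem fun i hi => (hp i).ne' ?_⟩
  rw [mem_zeroSet, hyt] at hi
  exact hi

/-- From a point off all walls one can move in every direction, so the points of a chart span the
whole space and nondegeneracy of the form applies. -/
theorem IsCornerChart.lorentzForm_nondegenerate (h : IsCornerChart n U φ) (hx : x ∈ U)
    {Z : ℝ × (Fin n → ℝ)} (hZ : ∀ y ∈ U, lorentzForm (hyperboloid (φ y)) Z = 0) : Z = 0 := by
  obtain ⟨c, hc, hc0⟩ := h.exists_zeroSet_eq_empty hx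
  refine eq_zero_of_lorentzForm_eq_zero fun Y => ?_
  have hev := h.exists_radial_eq hc (Y := Y) (by simp [hc0])
  obtain ⟨t, ⟨y, hy, s, -, hs⟩, ht⟩ :=
    ((hev.filter_mono nhdsWithin_le_nhds).and (self_mem_nhdsWithin (s := Ioi (0 : ℝ)))).exists
  have h1 := congrArg (lorentzForm Z) hs
  rw [map_smul, map_add, map_smul, lorentzForm_comm Z, lorentzForm_comm Z, hZ y hy, hZ c hc] at h1
  simpa [(ne_of_gt ht : t ≠ 0)] using h1.symm

/-- The points of the chart from which some geodesic through `x` can be prolonged beyond `x`. -/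
def throughPoints (U : Set X) (φ : X → Fin n → ℝ) (x : X) : Set X :=
  {y | y ∈ U ∧ ∃ z ∈ U, ∃ α > (0 : ℝ), ∃ β > (0 : ℝ),
    hyperboloid (φ x) = α • hyperboloid (φ y) + β • hyperboloid (φ z)}

/-- If `x` is a positive combination of two points of the corner, a coordinate vanishing at `x`
vanishes at both. Conversely, a direction tangent to the walls through `x` can be followed both
ways. -/
theorem IsCornerChart.span_throughPoints (h : IsCornerChart n U φ) (hx : x ∈ U) (Y) :
    Y ∈ Submodule.span ℝ ((fun y => hyperboloid (φ y)) '' throughPoints U φ x) ↔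
      ∀ i ∈ zeroSet (φ x), Y.2 i = 0 := by
  constructor
  · intro hY i hi
    induction hY using Submodule.span_induction with
    | mem Y hY =>
      obtain ⟨y, ⟨hy, z, hz, α, hα, β, hβ, he⟩, rfl⟩ := hY
      have h1 := congrFun (congrArg Prod.snd he) i
      simp only [hyperboloid, Prod.snd_add, Prod.smul_snd, Pi.add_apply, Pi.smul_apply,
        smul_eq_mul, mem_zeroSet.1 hi] at h1 ⊢
      have h2 := mul_nonneg hβ.le (h.nonneg hz i)
      have h3 := mul_nonneg hα.le (h.nonneg hy i)
      exact (mul_eq_zero.1 (by linarith : α * φ y i = 0)).resolve_left (ne_of_gt hα)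
    | zero => rfl
    | add Y Z _ _ h1 h2 => simp [h1, h2]
    | smul c Y _ h1 => simp [h1]
  · intro hY
    have hev := h.exists_radial_eq hx hY
    have hev' := h.exists_radial_eq hx (Y := -Y) (by simpa using hY)
    obtain ⟨t, ⟨⟨y, hy, s, hs, hys⟩, z, hz, s', hs', hzs⟩, ht⟩ :=
      (((hev.and hev').filter_mono nhdsWithin_le_nhds).and
        (self_mem_nhdsWithin (s := Ioi (0 : ℝ)))).exists
    have ht : 0 < t := ht
    -- The two displaced vectors average to the one of `x`, whence the coefficients `s / 2` and `s'
    -- / 2`.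
    have hyt : y ∈ throughPoints U φ x := ⟨hy, z, hz, s / 2, by positivity, s' / 2,
      by positivity, by
        rw [div_eq_inv_mul, div_eq_inv_mul, mul_smul, mul_smul, hys, hzs]; module⟩
    have hzt : z ∈ throughPoints U φ x := ⟨hz, y, hy, s' / 2, by positivity, s / 2,
      by positivity, by
        rw [div_eq_inv_mul, div_eq_inv_mul, mul_smul, mul_smul, hys, hzs]; module⟩
    have : Y = (2 * t)⁻¹ • (s • hyperboloid (φ y) - s' • hyperboloid (φ z)) := by
      rw [hys, hzs, show hyperboloid (φ x) + t • Y - (hyperboloid (φ x) + t • -Y) =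
        (2 * t) • Y by module, inv_smul_smul₀ (by positivity)]
    rw [this]
    exact Submodule.smul_mem _ _ (Submodule.sub_mem _
      (Submodule.smul_mem _ _ (Submodule.subset_span ⟨y, hyt, rfl⟩))
      (Submodule.smul_mem _ _ (Submodule.subset_span ⟨z, hzt, rfl⟩)))

/-- Linear relations between points of the hyperboloid do not depend on the chart. -/
theorem IsCornerChart.linearCombination_eq_zero (h : IsCornerChart n U φ)
    (h' : IsCornerChart n U ψ) (hx : x ∈ U) {T : Set X} (hT : T ⊆ U) {c : T →₀ ℝ}
    (hc : Finsupp.linearCombination ℝ (fun y : T => hyperboloid (φ y)) c = 0) :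
    Finsupp.linearCombination ℝ (fun y : T => hyperboloid (ψ y)) c = 0 := by
  -- It suffices to pair the combination with points of the chart, and those products are `cosh` of
  -- distances, hence the same for `φ` and `ψ`.
  refine h'.lorentzForm_nondegenerate hx fun z hz => ?_
  have h1 := congrArg (lorentzForm (hyperboloid (φ z))) hc
  rw [Finsupp.linearCombination_apply, map_finsuppSum, map_zero] at h1
  rw [Finsupp.linearCombination_apply, map_finsuppSum, ← h1]
  refine Finsupp.sum_congr fun y _ => ?_
  rw [map_smul, map_smul, lorentzForm_hyperboloid, lorentzForm_hyperboloid,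
    ← h.cosh_dist (hT y.2) hz, ← h'.cosh_dist (hT y.2) hz]

theorem IsCornerChart.throughPoints_subset (h : IsCornerChart n U φ)
    (h' : IsCornerChart n U ψ) (hx : x ∈ U) : throughPoints U φ x ⊆ throughPoints U ψ x := by
  rintro y ⟨hy, z, hz, α, hα, β, hβ, he⟩
  refine ⟨hy, z, hz, α, hα, β, hβ, ?_⟩
  have := h.linearCombination_eq_zero h' hx subset_rfl
    (c := Finsupp.single ⟨x, hx⟩ 1 - Finsupp.single ⟨y, hy⟩ α - Finsupp.single ⟨z, hz⟩ β)
    (by simp only [map_sub, Finsupp.linearCombination_single, one_smul, he]; abel)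
  simp only [map_sub, Finsupp.linearCombination_single, one_smul] at this
  rw [sub_sub, sub_eq_zero] at this
  exact this

theorem IsCornerChart.finrank_span_throughPoints (h : IsCornerChart n U φ) (hx : x ∈ U) :
    Module.finrank ℝ (Submodule.span ℝ ((fun y => hyperboloid (φ y)) '' throughPoints U φ x)) +
      (zeroSet (φ x)).ncard = 1 + n := by
  classical
  let f : ℝ × (Fin n → ℝ) →ₗ[ℝ] (zeroSet (φ x) → ℝ) :=
    (LinearMap.funLeft ℝ ℝ Subtype.val).comp (LinearMap.snd ℝ ℝ (Fin n → ℝ))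
  have hker : Submodule.span ℝ ((fun y => hyperboloid (φ y)) '' throughPoints U φ x) =
      LinearMap.ker f := by
    ext Y
    rw [h.span_throughPoints hx, LinearMap.mem_ker]
    exact ⟨fun hY => funext fun i => hY i i.2, fun hY i hi => congrFun hY ⟨i, hi⟩⟩
  have hsurj : Function.Surjective f :=
    (LinearMap.funLeft_surjective_of_injective ℝ ℝ _ Subtype.val_injective).comp
      Prod.snd_surjective
  have := f.finrank_range_add_finrank_ker
  rw [LinearMap.range_eq_top.2 hsurj, finrank_top, Module.finrank_fintype_fun_eq_card,
    Module.finrank_prod, Module.finrank_self, Module.finrank_fin_fun, ← hker,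
    ← Nat.card_eq_fintype_card, Nat.card_coe_set_eq] at this
  omega

/-- The through points are the same set for both charts and satisfy the same linear relations, so
their spans have equal dimension; the codimension of the span counts the walls. -/
theorem IsCornerChart.ncard_zeroSet_eq_aux (h : IsCornerChart n U φ)
    (h' : IsCornerChart n U ψ) (hx : x ∈ U) :
    (zeroSet (φ x)).ncard = (zeroSet (ψ x)).ncard := by
  have hN : throughPoints U φ x = throughPoints U ψ x :=
    (h.throughPoints_subset h' hx).antisymm (h'.throughPoints_subset h hx)
  have h1 := h.finrank_span_throughPoints hx
  have h2 := h'.finrank_span_throughPoints hx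
  rw [← hN] at h2
  have hsub : throughPoints U φ x ⊆ U := fun y hy => hy.1
  let f (χ : X → Fin n → ℝ) := Finsupp.linearCombination ℝ
    (fun y : throughPoints U φ x => hyperboloid (χ y))
  have hrange (χ : X → Fin n → ℝ) : LinearMap.range (f χ) =
      Submodule.span ℝ ((fun y => hyperboloid (χ y)) '' throughPoints U φ x) := by
    rw [Finsupp.range_linearCombination, image_eq_range]
  have hker : LinearMap.ker (f φ) = LinearMap.ker (f ψ) := by
    ext c
    exact ⟨fun hc => h.linearCombination_eq_zero h' hx hsub hc,
      fun hc => h'.linearCombination_eq_zero h hx hsub hc⟩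
  have e := (f φ).quotKerEquivRange.finrank_eq
  have e' := (f ψ).quotKerEquivRange.finrank_eq
  rw [hrange] at e e'
  rw [hker] at e
  omega

theorem IsCornerChart.ncard_zeroSet_eq {V : Set X} (h : IsCornerChart n U φ)
    (h' : IsCornerChart n V ψ) (hx : x ∈ U) (hx' : x ∈ V) :
    (zeroSet (φ x)).ncard = (zeroSet (ψ x)).ncard :=
  (h.inter_isOpen h'.isOpen).ncard_zeroSet_eq_aux
    (inter_comm V U ▸ h'.inter_isOpen h.isOpen) ⟨hx, hx'⟩

theorem IsCornerChart.mem_stratum_iff (h : IsCornerChart n U φ) (hx : x ∈ U) {k : ℕ} :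
    x ∈ (stratum n k : Set X) ↔ (zeroSet (φ x)).ncard = k := by
  constructor
  · rintro ⟨V, ψ, hψ, hxV, hk⟩
    rw [← hk]
    exact h.ncard_zeroSet_eq hψ hx hxV
  · exact fun hk => ⟨U, φ, h, hx, hk⟩

end Codimension


/-! ### Box neighbourhoods -/

section Box

variable {X : Type*} [MetricSpace X] {n : ℕ} {U N W : Set X} {φ : X → Fin n → ℝ} {x y : X} {ε : ℝ}

/-- `N` is a chart around `x` whose image is a box in the corner meeting only the walls
through `x`. -/
structure IsBox (N : Set X) (φ : X → Fin n → ℝ) (x : X) (ε : ℝ) : Prop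
    extends IsCornerChart n N φ where
  pos : 0 < ε
  mem : x ∈ N
  abs_sub_lt : ∀ y ∈ N, ∀ i, |φ y i - φ x i| < ε
  exists_eq : ∀ z ∈ corner n, (∀ i, |z i - φ x i| < ε) → ∃ y ∈ N, φ y = z
  le_of_notMem : ∀ i ∉ zeroSet (φ x), ε ≤ φ x i

theorem IsCornerChart.exists_isBox (h : IsCornerChart n U φ) (hx : x ∈ U) (hW : W ∈ 𝓝 x) :
    ∃ N ε, IsBox N φ x ε ∧ N ⊆ U ∩ W := by
  obtain ⟨δ, hδ, hδz⟩ :=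
    Metric.eventually_nhds_iff.1 (h.eventually_exists hx (interior_mem_nhds.2 hW))
  -- Below `δ` the box lies in the image of the chart; below the positive coordinates of `φ x` it
  -- avoids the walls not through `x`.
  have hev : ∀ᶠ ε : ℝ in 𝓝[>] 0, ε < δ ∧ ∀ i, i ∉ zeroSet (φ x) → ε ≤ φ x i := by
    refine Filter.Eventually.filter_mono nhdsWithin_le_nhds
      ((gt_mem_nhds hδ).and (Filter.eventually_all.2 fun i => ?_))
    by_cases hi : i ∈ zeroSet (φ x)
    · exact Filter.Eventually.of_forall fun _ h => absurd hi h
    · exact (ge_mem_nhds (lt_of_le_of_ne (h.nonneg hx i) (Ne.symm hi))).mono fun _ h _ => h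
  obtain ⟨ε, ⟨hεδ, hεi⟩, hε⟩ := (hev.and self_mem_nhdsWithin).exists
  have hε : 0 < ε := hε
  have hO : IsOpen {z : Fin n → ℝ | ∀ i, |z i - φ x i| < ε} := by
    simp only [ofPred_forall]
    exact isOpen_iInter_of_finite fun i =>
      isOpen_lt (by fun_prop) continuous_const
  refine ⟨U ∩ ((U ∩ φ ⁻¹' {z | ∀ i, |z i - φ x i| < ε}) ∩ interior W), ε,
    ⟨h.inter_isOpen ((h.continuousOn.isOpen_inter_preimage h.isOpen hO).inter isOpen_interior),
      hε, ⟨hx, ⟨hx, fun i => by simpa using hε⟩, mem_interior_iff_mem_nhds.2 hW⟩,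
      fun y hy => hy.2.1.2, fun z hz hzε => ?_, hεi⟩,
    fun y hy => ⟨hy.1, interior_subset hy.2.2⟩⟩
  obtain ⟨y, ⟨hyU, hyW⟩, rfl⟩ := hδz
    ((dist_pi_lt_iff hδ).2 fun i => (Real.dist_eq _ _).trans_lt ((hzε i).trans hεδ)) hz
  exact ⟨y, ⟨hyU, ⟨hyU, hzε⟩, hyW⟩, rfl⟩

namespace IsBox

theorem zeroSet_subset (h : IsBox N φ x ε) (hy : y ∈ N) : zeroSet (φ y) ⊆ zeroSet (φ x) := by
  intro i hi
  by_contra hix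
  have h1 := h.abs_sub_lt y hy i
  rw [mem_zeroSet.1 hi, zero_sub, abs_neg] at h1
  exact (h1.trans_le ((h.le_of_notMem i hix).trans (le_abs_self _))).false

/-- In coordinates the piece is a product of points and open intervals, cut at `0`. -/
theorem isPreconnected_piece (h : IsBox N φ x ε) {S : Set (Fin n)} (hS : S ⊆ zeroSet (φ x)) :
    IsPreconnected {y | y ∈ N ∧ zeroSet (φ y) = S} := by
  classical
  have : Nonempty X := ⟨x⟩
  let K : Fin n → Set ℝ := fun i =>
    if i ∈ S then {0} else Ioo (max 0 (φ x i - ε)) (φ x i + ε)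
  have hK : IsPreconnected (univ.pi K) := by
    refine isPreconnected_univ_pi fun i => ?_
    by_cases hi : i ∈ S
    · simp only [K, hi, if_true]
      exact isPreconnected_singleton
    · simp only [K, hi, if_false]
      exact isPreconnected_Ioo
  have hKS (z) (hz : z ∈ univ.pi K) : z ∈ corner n ∧ (∀ i, |z i - φ x i| < ε) ∧
      zeroSet z = S := by
    have h0 (i) (hi : i ∈ S) : z i = 0 := by simpa [K, hi] using hz i trivial
    have h1 (i) (hi : i ∉ S) : (0 < z i ∧ φ x i - ε < z i) ∧ z i < φ x i + ε := by
      simpa [K, hi] using hz i trivial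
    refine ⟨fun i => ?_, fun i => ?_, ?_⟩
    · by_cases hi : i ∈ S
      · exact (h0 i hi).ge
      · exact (h1 i hi).1.1.le
    · by_cases hi : i ∈ S
      · rw [h0 i hi, mem_zeroSet.1 (hS hi), sub_zero, abs_zero]
        exact h.pos
      · have := h1 i hi
        exact abs_sub_lt_iff.2 ⟨by linarith, by linarith⟩
    · ext i
      by_cases hi : i ∈ S
      · simp [hi, mem_zeroSet, h0 i hi]
      · simp [hi, mem_zeroSet, (h1 i hi).1.1.ne']
  have hsub : univ.pi K ⊆ φ '' N := fun z hz => by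
    obtain ⟨y, hy, rfl⟩ := h.exists_eq z (hKS z hz).1 (hKS z hz).2.1
    exact mem_image_of_mem φ hy
  have himg := hK.image _ (h.toIsCornerChart.continuousOn_invFunOn.mono hsub)
  convert himg using 1
  ext y
  constructor
  · rintro ⟨hy, hyS⟩
    refine ⟨φ y, fun i _ => ?_, h.injOn.leftInvOn_invFunOn hy⟩
    by_cases hi : i ∈ S
    · simp only [K, hi, if_true, mem_singleton_iff]
      rwa [← hyS] at hi
    · simp only [K, hi, if_false, mem_Ioo, max_lt_iff]
      have h1 := abs_sub_lt_iff.1 (h.abs_sub_lt y hy i)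
      rw [← hyS] at hi
      exact ⟨⟨lt_of_le_of_ne (h.nonneg hy i) (Ne.symm hi), by linarith⟩, by linarith⟩
  · rintro ⟨z, hz, rfl⟩
    obtain ⟨w, hw, rfl⟩ := hsub hz
    rw [h.injOn.leftInvOn_invFunOn hw]
    exact ⟨hw, (hKS _ hz).2.2⟩

end IsBox

/-- Increasing slightly the vanishing coordinates outside `S` leaves exactly the walls in `S`. -/
theorem IsCornerChart.mem_closure_piece (h : IsCornerChart n N φ) (hy : y ∈ N)
    {S : Set (Fin n)} (hS : S ⊆ zeroSet (φ y)) :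
    y ∈ closure {y | y ∈ N ∧ zeroSet (φ y) = S} := by
  classical
  refine mem_closure_iff_nhds.2 fun W hW => ?_
  let d : Fin n → ℝ := fun i => if φ y i = 0 ∧ i ∉ S then 1 else 0
  have hline : Filter.Tendsto (fun t : ℝ => φ y + t • d) (𝓝[>] 0) (𝓝 (φ y)) := by
    have : Continuous fun t : ℝ => φ y + t • d := by fun_prop
    refine Filter.Tendsto.mono_left ?_ nhdsWithin_le_nhds
    simpa using this.tendsto 0
  obtain ⟨t, ht, ht0⟩ := ((hline.eventually (h.eventually_exists hy hW)).and
    self_mem_nhdsWithin).exists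
  have ht0 : 0 < t := ht0
  have hd (i) : 0 ≤ d i := by simp only [d]; split_ifs <;> norm_num
  obtain ⟨w, ⟨hwN, hwW⟩, hw⟩ := ht fun i =>
    add_nonneg (h.nonneg hy i) (mul_nonneg ht0.le (hd i))
  refine ⟨w, hwW, hwN, ?_⟩
  ext i
  have hi := h.nonneg hy i
  rw [mem_zeroSet, hw]
  simp only [Pi.add_apply, Pi.smul_apply, smul_eq_mul, d]
  by_cases h0 : φ y i = 0
  · by_cases hiS : i ∈ S
    · simp [h0, hiS]
    · simp [h0, hiS, ht0.ne']
  · have : i ∉ S := fun hiS => h0 (hS hiS)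
    simp [h0, this]

end Box

/-! ### Faces near a point -/

section Faces

variable {X : Type*} [MetricSpace X] {n k : ℕ} {N F : Set X} {φ : X → Fin n → ℝ} {x y : X}
  {ε : ℝ}

theorem IsFace.isClosed (hF : IsFace n k F) : IsClosed F := by
  obtain ⟨x, -, rfl⟩ := hF
  exact isClosed_closure

theorem eq_zeroSet_of_mem_stratum {U : Set X} (h : IsCornerChart n U φ) (hx : x ∈ U) (hy : y ∈ U)
    (hxk : x ∈ (stratum n k : Set X)) (hyk : y ∈ (stratum n k : Set X))
    (hsub : zeroSet (φ y) ⊆ zeroSet (φ x)) : zeroSet (φ y) = zeroSet (φ x) :=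
  eq_of_subset_of_ncard_le hsub
    (((h.mem_stratum_iff hx).1 hxk).trans ((h.mem_stratum_iff hy).1 hyk).symm).le (toFinite _)

/-- A component of a stratum is closed in the stratum. -/
theorem mem_component_of_mem_closure (hX : IsRightAngledManifold n X)
    (hy : y ∈ closure (connectedComponentIn (stratum n k : Set X) x))
    (hyk : y ∈ (stratum n k : Set X)) : y ∈ connectedComponentIn (stratum n k : Set X) x := by
  obtain ⟨U, φ, h, hyU⟩ := hX y
  obtain ⟨N, ε, hN, -⟩ := h.exists_isBox hyU Filter.univ_mem
  obtain ⟨z, hzN, hz⟩ := mem_closure_iff_nhds.1 hy N (hN.isOpen.mem_nhds hN.mem)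
  have hzk := connectedComponentIn_subset _ _ hz
  rw [connectedComponentIn_eq hz]
  exact (hN.isPreconnected_piece subset_rfl).subset_connectedComponentIn
    ⟨hzN, eq_zeroSet_of_mem_stratum hN.toIsCornerChart hN.mem hzN hyk hzk
      (hN.zeroSet_subset hzN)⟩
    (fun w hw => (hN.mem_stratum_iff hw.1).2
      (hw.2 ▸ (hN.mem_stratum_iff hN.mem).1 hyk)) ⟨hN.mem, rfl⟩

/-- A face is the closure of the component of any of its points of the right codimension. -/
theorem IsFace.eq_closure (hX : IsRightAngledManifold n X) (hF : IsFace n k F) (hy : y ∈ F)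
    (hyk : y ∈ (stratum n k : Set X)) :
    F = closure (connectedComponentIn (stratum n k : Set X) y) := by
  obtain ⟨x, -, rfl⟩ := hF
  rw [connectedComponentIn_eq (mem_component_of_mem_closure hX hy hyk)]

theorem isFace_closure (hx : x ∈ (stratum n k : Set X)) :
    IsFace n k (closure (connectedComponentIn (stratum n k : Set X) x)) := ⟨x, hx, rfl⟩

theorem mem_closure_component (hx : x ∈ (stratum n k : Set X)) :
    x ∈ closure (connectedComponentIn (stratum n k : Set X) x) :=
  subset_closure (mem_connectedComponentIn hx)

/-- Every face contains a point of its stratum near each of its points. -/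
theorem IsFace.exists_mem_stratum (hF : IsFace n k F) (hx : x ∈ F) {W : Set X} (hW : W ∈ 𝓝 x) :
    ∃ y ∈ W, y ∈ F ∧ y ∈ (stratum n k : Set X) := by
  obtain ⟨z, hz, rfl⟩ := hF
  obtain ⟨y, hyW, hy⟩ := mem_closure_iff_nhds.1 hx W hW
  exact ⟨y, hyW, subset_closure hy, connectedComponentIn_subset _ _ hy⟩

theorem IsFace.nonempty (hF : IsFace n k F) : ∃ y ∈ F, y ∈ (stratum n k : Set X) := by
  obtain ⟨z, hz, rfl⟩ := hF
  exact ⟨z, mem_closure_component hz, hz⟩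

/-- `g i` is the facet spanned near `x` by the wall `i` of the chart. -/
structure IsFacetLabel (N : Set X) (φ : X → Fin n → ℝ) (x : X) (g : Fin n → Set X) : Prop where
  isFace : ∀ i ∈ zeroSet (φ x), IsFace n 1 (g i)
  mem_iff : ∀ y ∈ N, ∀ G, IsFace n 1 G → (y ∈ G ↔ ∃ i ∈ zeroSet (φ y), g i = G)

/-- The points of the box lying on wall `i` only form a connected set, so they determine one
component of the codimension-one stratum; `g i` is its closure. -/
theorem IsBox.exists_isFacetLabel (hX : IsRightAngledManifold n X) (h : IsBox N φ x ε) :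
    ∃ g, IsFacetLabel N φ x g := by
  have hp (i : zeroSet (φ x)) : ∃ y, y ∈ N ∧ zeroSet (φ y) = {i.1} := by
    have := h.toIsCornerChart.mem_closure_piece h.mem (singleton_subset_iff.2 i.2)
    exact closure_nonempty_iff.1 ⟨_, this⟩
  choose p hpN hp using hp
  have hps (i) : p i ∈ (stratum n 1 : Set X) :=
    (h.mem_stratum_iff (hpN i)).2 (by rw [hp, ncard_singleton])
  classical
  let g : Fin n → Set X := fun i => if hi : i ∈ zeroSet (φ x) then
    closure (connectedComponentIn (stratum n 1 : Set X) (p ⟨i, hi⟩)) else ∅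
  have hg (i) (hi : i ∈ zeroSet (φ x)) :
      g i = closure (connectedComponentIn (stratum n 1 : Set X) (p ⟨i, hi⟩)) := dif_pos hi
  have hpiece (i) (hi : i ∈ zeroSet (φ x)) : {y | y ∈ N ∧ zeroSet (φ y) = {i}} ⊆
      connectedComponentIn (stratum n 1 : Set X) (p ⟨i, hi⟩) :=
    (h.isPreconnected_piece (singleton_subset_iff.2 hi)).subset_connectedComponentIn
      ⟨hpN _, hp _⟩ fun w hw => (h.mem_stratum_iff hw.1).2 (by rw [hw.2, ncard_singleton])
  refine ⟨g, fun i hi => hg i hi ▸ isFace_closure (hps _), fun y hy G hG => ⟨fun hyG => ?_, ?_⟩⟩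
  -- A facet through `y` has codimension-one points arbitrarily close to `y`. In a box around `y`
  -- such a point lies on a single wall, which must pass through `y`.
  · obtain ⟨N', ε', hN', hsub⟩ := h.toIsCornerChart.exists_isBox hy Filter.univ_mem
    obtain ⟨w, hw, hwG, hws⟩ := hG.exists_mem_stratum hyG (hN'.isOpen.mem_nhds hN'.mem)
    obtain ⟨i, hi⟩ := ncard_eq_one.1 ((hN'.mem_stratum_iff hw).1 hws)
    have hiy : i ∈ zeroSet (φ y) := hN'.zeroSet_subset hw (hi ▸ mem_singleton i)
    have hix := h.zeroSet_subset hy hiy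
    refine ⟨i, hiy, ?_⟩
    rw [hg i hix, hG.eq_closure hX hwG hws,
      connectedComponentIn_eq (hpiece i hix ⟨(hsub hw).1, hi⟩)]
  · rintro ⟨i, hi, rfl⟩
    rw [hg i (h.zeroSet_subset hy hi)]
    exact closure_mono (hpiece i _)
      (h.toIsCornerChart.mem_closure_piece hy (singleton_subset_iff.2 hi))

theorem IsFacetLabel.mem {g : Fin n → Set X} (hg : IsFacetLabel N φ x g) (h : IsBox N φ x ε)
    (hy : y ∈ N) {i : Fin n} (hi : i ∈ zeroSet (φ y)) : y ∈ g i :=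
  (hg.mem_iff y hy _ (hg.isFace i (h.zeroSet_subset hy hi))).2 ⟨i, hi, rfl⟩

/-- Embeddedness enters here: if walls `i ≠ j` had the same label, a nearby point on exactly these
two would lie on only one facet. -/
theorem IsFacetLabel.injOn {g : Fin n → Set X} (hg : IsFacetLabel N φ x g) (h : IsBox N φ x ε)
    (hemb : EmbeddedFacets n X) : InjOn g (zeroSet (φ x)) := by
  intro i hi j hj hij
  by_contra hne
  obtain ⟨y, hyN, hy⟩ := closure_nonempty_iff.1
    ⟨x, h.toIsCornerChart.mem_closure_piece h.mem (insert_subset hi (singleton_subset_iff.2 hj))⟩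
  obtain ⟨G, H, hGH, hyG, hyH⟩ := hemb y
    ((h.mem_stratum_iff hyN).2 (by rw [hy, ncard_pair hne]))
  obtain ⟨a, ha, haG⟩ := (hg.mem_iff y hyN _ G.2).1 hyG
  obtain ⟨b, hb, hbH⟩ := (hg.mem_iff y hyN _ H.2).1 hyH
  have key (c) (hc : c ∈ zeroSet (φ y)) : g c = g i := by
    rw [hy] at hc
    rcases hc with rfl | hc
    · rfl
    · rw [mem_singleton_iff.1 hc, hij]
  exact hGH (Subtype.ext (by rw [← haG, ← hbH, key a ha, key b hb]))

theorem IsFacetLabel.mem_image_iff {g : Fin n → Set X} (hg : IsFacetLabel N φ x g)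
    (h : IsBox N φ x ε) (hinj : InjOn g (zeroSet (φ x))) (hy : y ∈ N) {i : Fin n}
    (hi : i ∈ zeroSet (φ x)) : y ∈ g i ↔ i ∈ zeroSet (φ y) := by
  refine ⟨fun hyi => ?_, hg.mem h hy⟩
  obtain ⟨j, hj, hji⟩ := (hg.mem_iff y hy _ (hg.isFace i hi)).1 hyi
  rwa [← hinj (h.zeroSet_subset hy hj) hi hji]

/-- The facets through a point of a stratum are locally constant along the stratum. -/
theorem eventually_mem_facet_iff (hX : IsRightAngledManifold n X)
    (hx : x ∈ (stratum n k : Set X)) : ∀ᶠ y in 𝓝 x, y ∈ (stratum n k : Set X) →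
      ∀ G, IsFace n 1 G → (y ∈ G ↔ x ∈ G) := by
  obtain ⟨U, φ, h, hxU⟩ := hX x
  obtain ⟨N, ε, hN, -⟩ := h.exists_isBox hxU Filter.univ_mem
  obtain ⟨g, hg⟩ := hN.exists_isFacetLabel hX
  filter_upwards [hN.isOpen.mem_nhds hN.mem] with y hy hyk G hG
  rw [hg.mem_iff y hy G hG, hg.mem_iff x hN.mem G hG,
    eq_zeroSet_of_mem_stratum hN.toIsCornerChart hN.mem hy hx hyk (hN.zeroSet_subset hy)]

theorem mem_facet_iff_of_isPreconnected (hX : IsRightAngledManifold n X) {C : Set X}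
    (hC : IsPreconnected C) (hCk : C ⊆ stratum n k) (hx : x ∈ C) (hy : y ∈ C) {G : Set X}
    (hG : IsFace n 1 G) : x ∈ G ↔ y ∈ G := by
  refine hC.induction₂' (fun a b => a ∈ G ↔ b ∈ G) (fun a ha => ?_)
    (fun _ _ _ _ _ _ h1 h2 => h1.trans h2) hx hy
  filter_upwards [(eventually_mem_facet_iff hX (hCk ha)).filter_mono nhdsWithin_le_nhds,
    self_mem_nhdsWithin] with b hb hbC
  exact ⟨(hb (hCk hbC) G hG).symm, hb (hCk hbC) G hG⟩

/-- The facets through an interior point of a face contain the face. -/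
theorem IsFace.subset_of_mem (hX : IsRightAngledManifold n X) (hF : IsFace n k F) (hy : y ∈ F)
    (hyk : y ∈ (stratum n k : Set X)) {G : Set X} (hG : IsFace n 1 G) (hyG : y ∈ G) : F ⊆ G := by
  rw [hF.eq_closure hX hy hyk]
  refine closure_minimal (fun z hz => ?_) hG.isClosed
  exact (mem_facet_iff_of_isPreconnected hX isPreconnected_connectedComponentIn
    (connectedComponentIn_subset _ _) (mem_connectedComponentIn hyk) hz hG).1 hyG

/-- Near `x`, the set `F` is cut out by the walls in `S`, which are labelled by the
facets containing `F`. -/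
structure IsFaceBox (k : ℕ) (F N : Set X) (φ : X → Fin n → ℝ) (x : X) (ε : ℝ)
    (g : Fin n → Set X) (S : Set (Fin n)) : Prop extends
    IsBox N φ x ε, IsFacetLabel N φ x g where
  injOn_label : InjOn g (zeroSet (φ x))
  subset_zeroSet : S ⊆ zeroSet (φ x)
  mem_iff_subset : ∀ i ∈ zeroSet (φ x), i ∈ S ↔ F ⊆ g i
  ncard_eq : S.ncard = k
  mem_face_iff : ∀ y ∈ N, y ∈ F ↔ S ⊆ zeroSet (φ y)

/-- Take for `S` the walls through some point of `F` of codimension `k` near `x`. Injectivity of the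
labels turns `S` into the walls whose facets contain `F`, so no second sheet of `F` can enter the
box. -/
theorem IsFace.exists_isFaceBox (hX : IsRightAngledManifold n X) (hemb : EmbeddedFacets n X)
    (hF : IsFace n k F) (hx : x ∈ F) : ∃ N φ ε g S, IsFaceBox (n := n) k F N φ x ε g S := by
  obtain ⟨U, φ, h, hxU⟩ := hX x
  obtain ⟨N, ε, hN, -⟩ := h.exists_isBox hxU Filter.univ_mem
  obtain ⟨g, hg⟩ := hN.exists_isFacetLabel hX
  have hinj := hg.injOn hN hemb
  obtain ⟨y, hyN, hyF, hyk⟩ := hF.exists_mem_stratum hx (hN.isOpen.mem_nhds hN.mem)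
  have hsub := hN.zeroSet_subset hyN
  have hS (i) (hi : i ∈ zeroSet (φ x)) : i ∈ zeroSet (φ y) ↔ F ⊆ g i := by
    rw [← hg.mem_image_iff hN hinj hyN hi]
    exact ⟨fun hyi => hF.subset_of_mem hX hyF hyk (hg.isFace i hi) hyi, fun hFi => hFi hyF⟩
  refine ⟨N, φ, ε, g, zeroSet (φ y), hN, hg, hinj, hsub, hS,
    (hN.mem_stratum_iff hyN).1 hyk, fun z hz => ⟨fun hzF i hi => ?_, fun hz0 => ?_⟩⟩
  · exact (hg.mem_image_iff hN hinj hz (hsub hi)).1 ((hS i (hsub hi)).1 hi hzF)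
  · rw [hF.eq_closure hX hyF hyk]
    refine closure_mono ?_ (hN.toIsCornerChart.mem_closure_piece hz hz0)
    exact (hN.isPreconnected_piece hsub).subset_connectedComponentIn ⟨hyN, rfl⟩
      fun w hw => (hN.mem_stratum_iff hw.1).2 (hw.2 ▸ (hN.mem_stratum_iff hyN).1 hyk)

end Faces


/-! ### A face is a right-angled manifold -/

section FaceManifold

variable {X : Type*} [MetricSpace X] {n m k : ℕ} {N F : Set X} {φ : X → Fin n → ℝ} {x y : X}
  {ε : ℝ} {g : Fin n → Set X} {S : Set (Fin n)} {e : Fin m → Fin n}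

theorem hypDist_comp {e : Fin m → Fin n} (he : Function.Injective e) {a b : Fin n → ℝ}
    (ha : ∀ i ∉ range e, a i = 0) (hb : ∀ i ∉ range e, b i = 0) :
    hypDist (a ∘ e) (b ∘ e) = hypDist a b := by
  unfold hypDist
  rw [Fintype.sum_of_injective e he (fun j => (a ∘ e) j ^ 2) (fun i => a i ^ 2)
      (fun i hi => by simp [ha i hi]) fun j => rfl,
    Fintype.sum_of_injective e he (fun j => (b ∘ e) j ^ 2) (fun i => b i ^ 2)
      (fun i hi => by simp [hb i hi]) fun j => rfl,
    Fintype.sum_of_injective e he (fun j => (a ∘ e) j * (b ∘ e) j) (fun i => a i * b i)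
      (fun i hi => by simp [ha i hi]) fun j => rfl]

theorem continuous_extend_zero {e : Fin m → Fin n} (he : Function.Injective e) :
    Continuous fun w : Fin m → ℝ => Function.extend e w 0 := by
  refine continuous_pi fun i => ?_
  by_cases hi : ∃ j, e j = i
  · obtain ⟨j, rfl⟩ := hi
    simp only [he.extend_apply]
    exact continuous_apply j
  · simp only [Function.extend_apply' _ _ _ hi]
    exact continuous_const

namespace IsFaceBox

theorem exists_enum (h : IsFaceBox k F N φ x ε g S) (hmk : m + k = n) :
    ∃ e : Fin m → Fin n, Function.Injective e ∧ range e = Sᶜ := by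
  have h1 := ncard_add_ncard_compl S
  rw [h.ncard_eq, Nat.card_eq_fintype_card, Fintype.card_fin] at h1
  have h2 : Nat.card (Sᶜ : Set (Fin n)) = m := by
    rw [Nat.card_coe_set_eq]
    omega
  let f := Finite.equivFinOfCardEq h2
  refine ⟨fun j => f.symm j, Subtype.val_injective.comp f.symm.injective, ?_⟩
  rw [show (fun j => (f.symm j : Fin n)) = Subtype.val ∘ f.symm from rfl,
    f.symm.surjective.range_comp, Subtype.range_coe]

theorem eq_zero (h : IsFaceBox k F N φ x ε g S) (hS : range e = Sᶜ) (hy : y ∈ N) (hyF : y ∈ F) :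
    ∀ i ∉ range e, φ y i = 0 := fun _ hi =>
  (h.mem_face_iff y hy).1 hyF (not_notMem.1 fun hiS => hi (hS ▸ hiS))

theorem isCornerChart_comp (h : IsFaceBox k F N φ x ε g S) (he : Function.Injective e)
    (hS : range e = Sᶜ) :
    IsCornerChart m (Subtype.val ⁻¹' N : Set F) (fun y => φ y ∘ e) where
  isOpen := h.isOpen.preimage continuous_subtype_val
  isometry y hy z hz := by
    rw [hypDist_comp he (h.eq_zero hS hy y.2) (h.eq_zero hS hz z.2)]
    exact h.isometry y hy z hz
  image := by
    obtain ⟨O, hO, hNO⟩ := h.image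
    -- Extension by zero inverts the restriction to the coordinates outside `S`, so the open set is
    -- pulled back along it.
    refine ⟨(fun w : Fin m → ℝ => Function.extend e w 0) ⁻¹' O,
      hO.preimage (continuous_extend_zero he), ?_⟩
    refine Subset.antisymm ?_ ?_
    · rintro _ ⟨y, hy, rfl⟩
      refine ⟨?_, fun j => h.nonneg hy (e j)⟩
      have : Function.extend e (φ y ∘ e) 0 = φ y := by
        funext i
        by_cases hi : ∃ j, e j = i
        · obtain ⟨j, rfl⟩ := hi
          rw [he.extend_apply]
          rfl
        · rw [Function.extend_apply' _ _ _ hi]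
          exact (h.eq_zero hS hy y.2 i hi).symm
      rw [mem_preimage, this]
      exact (hNO ▸ mem_image_of_mem φ hy : φ y ∈ O ∩ corner n).1
    · rintro w ⟨hwO, hw⟩
      have hwc : Function.extend e w 0 ∈ corner n := fun i => by
        by_cases hi : ∃ j, e j = i
        · obtain ⟨j, rfl⟩ := hi
          rw [he.extend_apply]
          exact hw j
        · rw [Function.extend_apply' _ _ _ hi]
          rfl
      obtain ⟨y, hy, hyw⟩ : Function.extend e w 0 ∈ φ '' N := hNO ▸ ⟨hwO, hwc⟩
      have hyF : y ∈ F := (h.mem_face_iff y hy).2 fun i hi => by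
        have hi' : ¬∃ j, e j = i := fun hj => by
          have : i ∈ range e := hj
          rw [hS] at this
          exact this hi
        rw [mem_zeroSet, hyw, Function.extend_apply' _ _ _ hi']
        rfl
      refine ⟨⟨y, hyF⟩, hy, funext fun j => ?_⟩
      simp only [Function.comp_apply, hyw, he.extend_apply]

theorem ncard_zeroSet_comp (h : IsFaceBox k F N φ x ε g S) (he : Function.Injective e)
    (hS : range e = Sᶜ) (hy : y ∈ N) (hyF : y ∈ F) :
    (zeroSet (φ y ∘ e)).ncard + k = (zeroSet (φ y)).ncard := by
  have h1 := (h.mem_face_iff y hy).1 hyF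
  rw [← ncard_image_of_injective _ he, ← h.ncard_eq, ← ncard_sdiff_add_ncard_of_subset h1]
  congr 2
  ext i
  constructor
  · rintro ⟨j, hj, rfl⟩
    have : e j ∈ range e := ⟨j, rfl⟩
    rw [hS] at this
    exact ⟨hj, this⟩
  · rintro ⟨hi, hiS⟩
    obtain ⟨j, rfl⟩ : i ∈ range e := hS ▸ hiS
    exact ⟨j, hi, rfl⟩

/-- The facets through `y` that do not contain the face are labelled by the walls
outside `S`. -/
theorem mem_iff_of_not_subset (h : IsFaceBox k F N φ x ε g S) (hy : y ∈ N) {H : Set X}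
    (hH : IsFace n 1 H) (hFH : ¬F ⊆ H) : y ∈ H ↔ ∃ i ∈ zeroSet (φ y), i ∉ S ∧ g i = H := by
  rw [h.mem_iff y hy H hH]
  refine exists_congr fun i => and_congr_right fun hi => ⟨fun hg => ⟨fun hiS => hFH ?_, hg⟩,
    fun hg => hg.2⟩
  rw [← hg]
  exact (h.mem_iff_subset i (h.zeroSet_subset hy hi)).1 hiS

end IsFaceBox

variable (hmk : m + k = n) (hX : IsRightAngledManifold n X) (hemb : EmbeddedFacets n X)
  (hF : IsFace n k F)

include hmk hX hemb hF

theorem IsFace.isRightAngledManifold : IsRightAngledManifold m F := fun x => by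
  obtain ⟨N, φ, ε, g, S, h⟩ := hF.exists_isFaceBox hX hemb x.2
  obtain ⟨e, he, hS⟩ := h.exists_enum hmk
  exact ⟨_, _, h.isCornerChart_comp he hS, h.mem⟩

/-- The shift by `k` accounts for the walls in `S`, which pass through every point of `F` in the
box. -/
theorem IsFace.mem_stratum_iff {x : F} {j : ℕ} :
    x ∈ (stratum m j : Set F) ↔ (x : X) ∈ (stratum n (j + k) : Set X) := by
  obtain ⟨N, φ, ε, g, S, h⟩ := hF.exists_isFaceBox hX hemb x.2
  obtain ⟨e, he, hS⟩ := h.exists_enum hmk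
  rw [(h.isCornerChart_comp he hS).mem_stratum_iff h.mem, h.mem_stratum_iff h.mem,
    ← h.ncard_zeroSet_comp he hS h.mem x.2, add_left_inj]

/-- The elements of `adj(F)` are the facets that meet `F` but do not contain it. -/
theorem IsFace.mem_adj_iff {H : Facet n X} : H ∈ adj n m F ↔ (∃ x ∈ F, x ∈ H.1) ∧ ¬F ⊆ H.1 := by
  have key (x : F) (hx : x ∈ interiorPoints m F) (hxH : (x : X) ∈ H.1) : F ⊆ H.1 := by
    have hxk := (hF.mem_stratum_iff hmk hX hemb).1 hx
    rw [zero_add] at hxk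
    exact hF.subset_of_mem hX x.2 hxk H.2 hxH
  constructor
  · rintro ⟨⟨x, -, hxH⟩, hint⟩
    refine ⟨⟨x, x.2, hxH⟩, fun hFH => ?_⟩
    obtain ⟨y, hyF, hyk⟩ := hF.nonempty
    rw [← zero_add k] at hyk
    exact hint ⟨y, hyF⟩ ((hF.mem_stratum_iff hmk hX hemb).2 hyk) (hFH hyF)
  · rintro ⟨⟨x, hxF, hxH⟩, hFH⟩
    exact ⟨⟨⟨x, hxF⟩, fun hint => hFH (key _ hint hxH), hxH⟩,
      fun y hy hyH => hFH (key y hy hyH)⟩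

/-- A facet of `X` through an interior point of a facet of `F` contains that facet of `F`. -/
theorem IsFace.image_subset_of_mem {G : Facet m F} {y : F} (hyG : y ∈ G.1)
    (hy : y ∈ (stratum m 1 : Set F)) {H : Set X} (hH : IsFace n 1 H) (hyH : (y : X) ∈ H) :
    Subtype.val '' G.1 ⊆ H := by
  rw [image_subset_iff, G.2.eq_closure (hF.isRightAngledManifold hmk hX hemb) hyG hy]
  refine closure_minimal (fun z hz => ?_) (hH.isClosed.preimage continuous_subtype_val)
  refine (mem_facet_iff_of_isPreconnected hX (k := 1 + k)
    (isPreconnected_connectedComponentIn.image Subtype.val continuous_subtype_val.continuousOn) ?_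
    (mem_image_of_mem _ (mem_connectedComponentIn hy)) (mem_image_of_mem _ hz) hH).1 hyH
  rintro _ ⟨w, hw, rfl⟩
  exact (hF.mem_stratum_iff hmk hX hemb).1 (connectedComponentIn_subset _ _ hw)

/-- The natural map `Fac(F) → adj(F)` is well defined. -/
theorem IsFace.existsUnique_adj (G : Facet m F) :
    ∃! H : adj n m F, Subtype.val '' G.1 ⊆ H.1.1 := by
  obtain ⟨y, hyG, hy⟩ := G.2.nonempty
  obtain ⟨N, φ, ε, g, S, h⟩ := hF.exists_isFaceBox hX hemb y.2
  have hyk := (h.mem_stratum_iff h.mem).1 ((hF.mem_stratum_iff hmk hX hemb).1 hy)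
  -- The point `y` has codimension `1 + k` in `X`, so just one wall through it lies outside `S`.
  -- This single wall gives both existence and uniqueness.
  obtain ⟨i, hi⟩ : ∃ i, zeroSet (φ y) \ S = {i} := by
    rw [← ncard_eq_one]
    have := ncard_sdiff_add_ncard_of_subset h.subset_zeroSet
    rw [h.ncard_eq] at this
    omega
  obtain ⟨hiy, hiS⟩ : i ∈ zeroSet (φ y) \ S := hi ▸ mem_singleton i
  have hyi : (y : X) ∈ g i := h.toIsFacetLabel.mem h.toIsBox h.mem hiy
  have hadj : (⟨g i, h.isFace i hiy⟩ : Facet n X) ∈ adj n m F :=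
    (hF.mem_adj_iff hmk hX hemb).2
      ⟨⟨y, y.2, hyi⟩, fun hFi => hiS ((h.mem_iff_subset i hiy).2 hFi)⟩
  refine ⟨⟨_, hadj⟩, hF.image_subset_of_mem hmk hX hemb hyG hy (h.isFace i hiy) hyi,
    fun H hH => ?_⟩
  obtain ⟨j, hj, hjS, hjH⟩ := (h.mem_iff_of_not_subset h.mem H.1.2
    ((hF.mem_adj_iff hmk hX hemb).1 H.2).2).1 (hH (mem_image_of_mem _ hyG))
  have : j ∈ zeroSet (φ y) \ S := ⟨hj, hjS⟩
  rw [hi, mem_singleton_iff] at this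
  refine Subtype.ext (Subtype.ext ?_)
  rw [← hjH, this]

/-- Near `x`, the facets of `F` are labelled by the walls outside `S`. -/
theorem IsFace.exists_label (x : F) :
    ∃ N φ ε g S, IsFaceBox (n := n) k F N φ x ε g S ∧ ∃ e : Fin m → Fin n,
      Function.Injective e ∧ range e = Sᶜ ∧ ∃ g' : Fin m → Set F,
        (∀ G, IsFace m 1 G → (x ∈ G ↔ ∃ j ∈ zeroSet (φ x ∘ e), g' j = G)) ∧
        ∀ j ∈ zeroSet (φ x ∘ e), IsFace m 1 (g' j) ∧ ∃ y ∈ g' j, (y : X) ∈ N ∧ y ∈ (stratum m 1 : Set F) ∧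
          zeroSet (φ y ∘ e) = {j} := by
  obtain ⟨N, φ, ε, g, S, h⟩ := hF.exists_isFaceBox hX hemb x.2
  obtain ⟨e, he, hS⟩ := h.exists_enum hmk
  have hc := h.isCornerChart_comp he hS
  obtain ⟨N', ε', hN', hsub⟩ := hc.exists_isBox h.mem Filter.univ_mem
  obtain ⟨g', hg'⟩ := hN'.exists_isFacetLabel (hF.isRightAngledManifold hmk hX hemb)
  refine ⟨N, φ, ε, g, S, h, e, he, hS, g', hg'.mem_iff x hN'.mem, fun j hj => ?_⟩
  obtain ⟨y, hyN, hy⟩ := closure_nonempty_iff.1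
    ⟨x, hN'.toIsCornerChart.mem_closure_piece hN'.mem (singleton_subset_iff.2 hj)⟩
  exact ⟨hg'.isFace j hj, y, hg'.mem hN' hyN (hy ▸ mem_singleton j : j ∈ zeroSet (φ y ∘ e)), (hsub hyN).1,
    (hN'.mem_stratum_iff hyN).2 (by rw [hy, ncard_singleton]), hy⟩

/-- Every facet of `X` meeting but not containing `F` contains a facet of `F` through any given
common point. -/
theorem IsFace.exists_facet_subset (x : F) {H : Set X} (hH : IsFace n 1 H) (hFH : ¬F ⊆ H)
    (hxH : (x : X) ∈ H) : ∃ G : Facet m F, x ∈ G.1 ∧ Subtype.val '' G.1 ⊆ H := by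
  obtain ⟨N, φ, ε, g, S, h, e, he, hS, g', hg', hy⟩ := hF.exists_label hmk hX hemb x
  obtain ⟨i, hi, hiS, rfl⟩ := (h.mem_iff_of_not_subset h.mem hH hFH).1 hxH
  obtain ⟨j, rfl⟩ : i ∈ range e := hS ▸ hiS
  obtain ⟨hf, y, hyj, hyN, hy1, hyz⟩ := hy j hi
  refine ⟨⟨g' j, hf⟩, (hg' _ hf).2 ⟨j, hi, rfl⟩,
    hF.image_subset_of_mem hmk hX hemb hyj hy1 hH (h.toIsFacetLabel.mem h.toIsBox hyN ?_)⟩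
  exact (hyz ▸ mem_singleton j : j ∈ zeroSet (φ y ∘ e))

/-- The natural map `Fac(F) → adj(F)` is injective on the facets through a given point. -/
theorem IsFace.facet_eq_of_subset (x : F) {H : Set X} (hH : IsFace n 1 H) (hFH : ¬F ⊆ H)
    {G₁ G₂ : Facet m F} (h1 : x ∈ G₁.1) (h2 : x ∈ G₂.1) (hG₁ : Subtype.val '' G₁.1 ⊆ H)
    (hG₂ : Subtype.val '' G₂.1 ⊆ H) : G₁ = G₂ := by
  obtain ⟨N, φ, ε, g, S, h, e, he, hS, g', hg', hy⟩ := hF.exists_label hmk hX hemb x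
  obtain ⟨i, hi, hiS, rfl⟩ := (h.mem_iff_of_not_subset h.mem hH hFH).1 (hG₁ ⟨x, h1, rfl⟩)
  have key (G : Facet m F) (hx : x ∈ G.1) (hG : Subtype.val '' G.1 ⊆ g i) :
      ∃ j, e j = i ∧ g' j = G.1 := by
    obtain ⟨j, hj, hjG⟩ := (hg' _ G.2).1 hx
    obtain ⟨-, y, hyj, hyN, -, hyz⟩ := hy j hj
    have hyi := (h.toIsFacetLabel.mem_image_iff h.toIsBox h.injOn_label hyN hi).1
      (hG ⟨y, hjG ▸ hyj, rfl⟩)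
    obtain ⟨l, rfl⟩ : i ∈ range e := hS ▸ hiS
    have : l ∈ zeroSet (φ y ∘ e) := hyi
    rw [hyz, mem_singleton_iff] at this
    exact ⟨j, by rw [this], hjG⟩
  obtain ⟨j₁, hj₁, hg₁⟩ := key G₁ h1 hG₁
  obtain ⟨j₂, hj₂, hg₂⟩ := key G₂ h2 hG₂
  rw [← hj₂] at hj₁
  exact Subtype.ext (by rw [← hg₁, ← hg₂, he hj₁])

/-- The two walls outside `S` have different labels, both in `adj(F)`. A facet of `F` contained in
both would contradict the uniqueness in `IsFace.existsUnique_adj`. -/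
theorem IsFace.embeddedFacets : EmbeddedFacets m F := by
  intro x hx
  obtain ⟨N, φ, ε, g, S, h⟩ := hF.exists_isFaceBox hX hemb x.2
  have hxk := (h.mem_stratum_iff h.mem).1 ((hF.mem_stratum_iff hmk hX hemb).1 hx)
  obtain ⟨i, j, hij, hS⟩ : ∃ i j, i ≠ j ∧ zeroSet (φ x) \ S = {i, j} := by
    rw [← ncard_eq_two]
    have := ncard_sdiff_add_ncard_of_subset h.subset_zeroSet
    rw [h.ncard_eq] at this
    omega
  have key (l) (hl : l ∈ zeroSet (φ x) \ S) :
      ∃ G : Facet m F, x ∈ G.1 ∧ Subtype.val '' G.1 ⊆ g l :=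
    hF.exists_facet_subset hmk hX hemb x (h.isFace l hl.1)
      (fun hFl => hl.2 ((h.mem_iff_subset l hl.1).2 hFl))
      (h.toIsFacetLabel.mem h.toIsBox h.mem hl.1)
  have hi : i ∈ zeroSet (φ x) \ S := by simp [hS]
  have hj : j ∈ zeroSet (φ x) \ S := by simp [hS]
  obtain ⟨G, hxG, hGi⟩ := key i hi
  obtain ⟨H, hxH, hHj⟩ := key j hj
  refine ⟨G, H, ?_, hxG, hxH⟩
  rintro rfl
  have hadj (l) (hl : l ∈ zeroSet (φ x) \ S) :
      (⟨g l, h.isFace l hl.1⟩ : Facet n X) ∈ adj n m F :=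
    (hF.mem_adj_iff hmk hX hemb).2 ⟨⟨x, x.2, h.toIsFacetLabel.mem h.toIsBox h.mem hl.1⟩,
      fun hFl => hl.2 ((h.mem_iff_subset l hl.1).2 hFl)⟩
  have := (hF.existsUnique_adj hmk hX hemb G).unique (y₁ := ⟨_, hadj i hi⟩)
    (y₂ := ⟨_, hadj j hj⟩) hGi hHj
  exact hij (h.injOn_label hi.1 hj.1 (congrArg (fun H => H.1.1) this))

/-! ### Properness of the induced coloring -/

variable {V : Type*} [AddCommGroup V] [Module (ZMod 2) V] {lam : Facet n X → V}

/-- The facets of `F` through `x` go injectively to facets of `X` through `x` outside `supp(F)`. As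
all of `supp(F)` also passes through `x`, independence at `x` makes the two spans disjoint, and the
quotient map keeps the first family independent. -/
theorem IsFace.isColoring (hlam : IsColoring n X lam) {π : Facet m F → adj n m F}
    (hπ : ∀ G, Subtype.val '' G.1 ⊆ (π G).1.1) :
    IsColoring m F (inducedColoring F lam π) := by
  intro x
  have hlx := hlam x
  have hmem (G : Facet m F) (hx : x ∈ G.1) : (x : X) ∈ (π G).1.1 := hπ G ⟨x, hx, rfl⟩
  let τ : {G : Facet m F // x ∈ G.1} → {H : Facet n X // (x : X) ∈ H.1} :=
    fun G => ⟨(π G.1).1, hmem G.1 G.2⟩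
  have hnot (G) : (π G).1 ∉ supp n F := ((hF.mem_adj_iff hmk hX hemb).1 (π G).2).2
  have hτ : Function.Injective τ := by
    intro G₁ G₂ h
    have h' : (π G₁.1).1 = (π G₂.1).1 := congrArg (fun H => H.1) h
    refine Subtype.ext (hF.facet_eq_of_subset hmk hX hemb x (π G₁.1).1.2 (hnot G₁.1) G₁.2 G₂.2
      (hπ _) ?_)
    rw [h']
    exact hπ _
  have hli := hlx.comp τ hτ
  refine hli.map (f := (Submodule.span (ZMod 2) (lam '' supp n F)).mkQ) ?_
  rw [Submodule.ker_mkQ]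
  have hdis : Disjoint (range τ) {H | H.1 ∈ supp n F} := by
    rw [Set.disjoint_left]
    rintro _ ⟨G, rfl⟩ hG
    exact hnot _ hG
  have := hlx.disjoint_span_image hdis
  have hrange : (fun H : {H : Facet n X // (x : X) ∈ H.1} => lam H.1) '' range τ =
      range ((fun H : {H : Facet n X // (x : X) ∈ H.1} => lam H.1) ∘ τ) := (range_comp _ _).symm
  have hsupp : (fun H : {H : Facet n X // (x : X) ∈ H.1} => lam H.1) '' {H | H.1 ∈ supp n F} =
      lam '' supp n F := by
    ext u
    constructor
    · rintro ⟨H, hH, rfl⟩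
      exact ⟨H.1, hH, rfl⟩
    · rintro ⟨H, hH, rfl⟩
      exact ⟨⟨H, hH x.2⟩, hH, rfl⟩
  rw [hrange, hsupp] at this
  exact this

end FaceManifold


/-! ### Orthogonal projection to an intersection of walls -/

section Projection

variable {n : ℕ}

/-- The orthogonal projection of the hyperbolic space to the subspace `xᵢ = 0`, `i ∈ S`. -/
noncomputable def orthProj (S : Finset (Fin n)) (a : Fin n → ℝ) : Fin n → ℝ :=
  fun i => if i ∈ S then 0 else a i / √(1 + ∑ j ∈ S, a j ^ 2)

theorem orthProj_apply_of_mem {S : Finset (Fin n)} {i : Fin n} (hi : i ∈ S) (a : Fin n → ℝ) :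
    orthProj S a i = 0 := if_pos hi

theorem orthProj_eq_self {S : Finset (Fin n)} {a : Fin n → ℝ} (ha : ∀ i ∈ S, a i = 0) :
    orthProj S a = a := by
  have h0 : ∑ j ∈ S, a j ^ 2 = 0 := Finset.sum_eq_zero fun j hj => by simp [ha j hj]
  funext i
  by_cases hi : i ∈ S
  · rw [orthProj_apply_of_mem hi, ha i hi]
  · simp [orthProj, hi, h0]

theorem orthProj_nonneg {S : Finset (Fin n)} {a : Fin n → ℝ} (ha : a ∈ corner n) :
    orthProj S a ∈ corner n := fun i => by
  unfold orthProj
  split_ifs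
  · exact le_rfl
  · exact div_nonneg (ha i) (Real.sqrt_nonneg _)

theorem zeroSet_subset_orthProj (S : Finset (Fin n)) (a : Fin n → ℝ) :
    zeroSet a ⊆ zeroSet (orthProj S a) := fun i hi => by
  simp [mem_zeroSet, orthProj, mem_zeroSet.1 hi]

theorem continuous_orthProj (S : Finset (Fin n)) : Continuous (orthProj S) := by
  refine continuous_pi fun i => ?_
  by_cases hi : i ∈ S
  · simp only [orthProj, hi, if_true]
    exact continuous_const
  · simp only [orthProj, hi, if_false]
    refine (continuous_apply i).div (by fun_prop) fun a => ?_
    positivity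

/-- Deleting the coordinates in `S` raises the Lorentz square from `1` to `1 + ∑ j ∈ S, a j ^ 2`;
dividing by the root returns to the hyperboloid. -/
theorem timeCoord_orthProj (S : Finset (Fin n)) (a : Fin n → ℝ) :
    timeCoord (orthProj S a) = timeCoord a / √(1 + ∑ j ∈ S, a j ^ 2) := by
  have hc : 0 < 1 + ∑ j ∈ S, a j ^ 2 := by positivity
  unfold timeCoord
  rw [← Real.sqrt_div' _ hc.le]
  congr 1
  have h1 : ∑ i, orthProj S a i ^ 2 = (∑ i ∈ Sᶜ, a i ^ 2) / (1 + ∑ j ∈ S, a j ^ 2) := by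
    rw [← Finset.sum_add_sum_compl S, Finset.sum_eq_zero fun i hi => by simp [orthProj, hi],
      zero_add, Finset.sum_div]
    refine Finset.sum_congr rfl fun i hi => ?_
    rw [Finset.mem_compl] at hi
    simp only [orthProj, hi, if_false, div_pow, Real.sq_sqrt hc.le]
  rw [h1, ← Finset.sum_add_sum_compl S (fun i => a i ^ 2)]
  field_simp
  ring

theorem lorentz_orthProj (S : Finset (Fin n)) (a b : Fin n → ℝ) :
    lorentz (orthProj S a) (orthProj S b) = (lorentz a b + ∑ i ∈ S, a i * b i) /
      (√(1 + ∑ j ∈ S, a j ^ 2) * √(1 + ∑ j ∈ S, b j ^ 2)) := by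
  have h1 : ∑ i, orthProj S a i * orthProj S b i = (∑ i ∈ Sᶜ, a i * b i) /
      (√(1 + ∑ j ∈ S, a j ^ 2) * √(1 + ∑ j ∈ S, b j ^ 2)) := by
    rw [← Finset.sum_add_sum_compl S, Finset.sum_eq_zero fun i hi => by simp [orthProj, hi],
      zero_add, Finset.sum_div]
    refine Finset.sum_congr rfl fun i hi => ?_
    rw [Finset.mem_compl] at hi
    simp only [orthProj, hi, if_false, div_mul_div_comm]
  rw [lorentz, h1, timeCoord_orthProj, timeCoord_orthProj, lorentz,
    ← Finset.sum_add_sum_compl S (fun i => a i * b i), div_mul_div_comm, ← sub_div]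
  congr 1
  ring

/-- The orthogonal projection does not increase distances. -/
theorem hypDist_orthProj_le (S : Finset (Fin n)) (a b : Fin n → ℝ) :
    hypDist (orthProj S a) (orthProj S b) ≤ hypDist a b := by
  rw [hypDist_le_iff, lorentz_orthProj, div_le_iff₀ (by positivity)]
  have hM := one_le_lorentz a b
  have hC : (∑ i ∈ S, a i * b i) ^ 2 ≤ (∑ i ∈ S, a i ^ 2) * ∑ i ∈ S, b i ^ 2 :=
    Finset.sum_mul_sq_le_sq_mul_sq _ _ _
  have ha : 0 ≤ ∑ i ∈ S, a i ^ 2 := by positivity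
  have hb : 0 ≤ ∑ i ∈ S, b i ^ 2 := by positivity
  rw [← Real.sqrt_mul (by positivity)]
  generalize ∑ i ∈ S, a i ^ 2 = A at *
  generalize ∑ i ∈ S, b i ^ 2 = B at *
  generalize ∑ i ∈ S, a i * b i = C at *
  -- Cauchy–Schwarz for `C²` and the arithmetic-geometric mean for `2|C|`. Then `M + C ≤ M * (1 +
  -- |C|)` because `M ≥ 1`.
  have h1 : 1 + |C| ≤ √((1 + A) * (1 + B)) := by
    refine Real.le_sqrt_of_sq_le ?_
    have : (2 * |C|) ^ 2 ≤ (A + B) ^ 2 := by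
      rw [mul_pow, sq_abs]
      nlinarith [sq_nonneg (A - B)]
    have := abs_le_of_sq_le_sq this (by positivity)
    rw [abs_of_nonneg (by positivity)] at this
    nlinarith [sq_abs C]
  nlinarith [le_abs_self C, abs_nonneg C]

end Projection

/-! ### Identifications in real toric manifolds -/

namespace RealToric

variable {V : Type*} [AddCommGroup V] {n : ℕ} {X : Type*} [MetricSpace X] {lam : Facet n X → V}

theorem mk_add (v : V) {G : Facet n X} {x : X} (hx : x ∈ G.1) :
    mk lam (v + lam G) x = mk lam v x := (Quot.sound (Glue.glue v G x hx)).symm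

theorem exists_eq_mk (p : RealToric n X lam) : ∃ v x, p = mk lam v x := by
  obtain ⟨⟨v, x⟩, rfl⟩ := Quot.exists_rep p
  exact ⟨v, x, rfl⟩

/-- An elementary gluing fixes the point and shifts the copy by the color of a facet through it; the
generated relation therefore shifts by the span. -/
theorem mk_eq_mk_iff [Module (ZMod 2) V] {v w : V} {x y : X} : mk lam v x = mk lam w y ↔
    x = y ∧ w - v ∈ Submodule.span (ZMod 2) (lam '' {G | x ∈ G.1}) := by
  constructor
  · intro h
    have h1 := Quot.eqvGen_exact h
    suffices ∀ p q : (Σ _ : V, X), Relation.EqvGen (Glue n X lam) p q →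
        p.2 = q.2 ∧ q.1 - p.1 ∈ Submodule.span (ZMod 2) (lam '' {G | p.2 ∈ G.1}) from
      this _ _ h1
    intro p q hpq
    induction hpq with
    | rel p q h =>
      obtain ⟨v, G, x, hx⟩ := h
      refine ⟨rfl, ?_⟩
      rw [add_sub_cancel_left]
      exact Submodule.subset_span ⟨G, hx, rfl⟩
    | refl p => exact ⟨rfl, by rw [sub_self]; exact Submodule.zero_mem _⟩
    | symm p q _ h =>
      refine ⟨h.1.symm, ?_⟩
      rw [← neg_sub, ← h.1]
      exact Submodule.neg_mem _ h.2
    | trans p q r _ _ h1 h2 =>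
      refine ⟨h1.1.trans h2.1, ?_⟩
      rw [← sub_add_sub_cancel]
      exact Submodule.add_mem _ (h1.1 ▸ h2.2) h1.2
  · rintro ⟨rfl, h⟩
    suffices ∀ u ∈ Submodule.span (ZMod 2) (lam '' {G | x ∈ G.1}), ∀ v,
        mk lam (v + u) x = mk lam v x by
      have := this _ h v
      rw [add_sub_cancel] at this
      exact this.symm
    intro u hu
    induction hu using Submodule.span_induction with
    | mem u hu =>
      obtain ⟨G, hG, rfl⟩ := hu
      exact fun v => mk_add v hG
    | zero => exact fun v => by rw [add_zero]
    | add u u' _ _ h1 h2 => exact fun v => by rw [← add_assoc, h2, h1]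
    | smul c u _ h1 =>
      intro v
      -- Over two elements a scalar multiple is zero or the vector itself, so the linear span is
      -- reached by successive gluings.
      have : c = 0 ∨ c = 1 := by revert c; decide
      rcases this with rfl | rfl
      · rw [zero_smul, add_zero]
      · rw [one_smul, h1]

theorem continuous_mk (v : V) : Continuous (mk lam v) :=
  continuous_quot_mk.comp (continuous_sigmaMk (σ := fun _ : V => X))

theorem isOpen_iff {A : Set (RealToric n X lam)} : IsOpen A ↔ ∀ v, IsOpen (mk lam v ⁻¹' A) := by
  refine ⟨fun h v => h.preimage (continuous_mk v), fun h => ?_⟩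
  refine isQuotientMap_quot_mk.isOpen_preimage.1 (isOpen_sigma_iff.2 h)

theorem isClosed_iff {A : Set (RealToric n X lam)} :
    IsClosed A ↔ ∀ v, IsClosed (mk lam v ⁻¹' A) := by
  simp only [← isOpen_compl_iff, isOpen_iff, preimage_compl]

theorem HasChain.glueDist_le {p q : RealToric n X lam} {l : ℝ≥0∞} (h : HasChain p q l) :
    glueDist p q ≤ l := sInf_le h

end RealToric

/-! ### The real toric manifold of a face -/

section FaceToric

open RealToric

variable {V : Type*} [AddCommGroup V] [Module (ZMod 2) V] {n m k : ℕ} {X : Type*}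
  [MetricSpace X] {lam : Facet n X → V} {F : Set X} {π : Facet m F → adj n m F}

theorem mk_eq_mk_of_facets {x y : X} (hxy : ∀ G, IsFace n 1 G → x ∈ G → y ∈ G) {v w : V}
    (h : mk lam v x = mk lam w x) : mk lam v y = mk lam w y :=
  mk_eq_mk_iff.2 ⟨rfl, Submodule.span_mono (image_mono fun G hG => hxy G.1 G.2 hG)
    (mk_eq_mk_iff.1 h).2⟩

/-- Over `F`, the copies of `X` indexed by elements of the same coset are identified. -/
theorem mk_eq_mk_of_quotient {v w : V} (x : F)
    (h : (Submodule.Quotient.mk v : V ⧸ Submodule.span (ZMod 2) (lam '' supp n F)) =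
      Submodule.Quotient.mk w) : mk lam v x = mk lam w x := by
  have hsub : supp n F ⊆ {G : Facet n X | (x : X) ∈ G.1} := fun G hG => hG x.2
  exact mk_eq_mk_iff.2 ⟨rfl, Submodule.span_mono (image_mono hsub)
    ((Submodule.Quotient.eq _).1 h.symm)⟩

/-- The natural map `[v̄, x] ↦ [v, x]` from `M(F, lam_F)` to `M(X, lam)`. -/
noncomputable def faceMap (hπ : ∀ G, Subtype.val '' G.1 ⊆ (π G).1.1) :
    RealToric m F (inducedColoring F lam π) → RealToric n X lam :=
  Quot.lift (fun p => mk lam (Function.surjInv (Submodule.mkQ_surjective _) p.1) p.2) (by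
    rintro _ _ ⟨v, G, x, hx⟩
    obtain ⟨v, rfl⟩ := Submodule.mkQ_surjective _ v
    refine (mk_eq_mk_of_quotient (w := v) x
      (Function.surjInv_eq (Submodule.mkQ_surjective _) _)).trans ?_
    rw [← mk_add v (hπ G ⟨x, hx, rfl⟩)]
    exact (mk_eq_mk_of_quotient x (Function.surjInv_eq (Submodule.mkQ_surjective _) _)).symm)

variable (hπ : ∀ G, Subtype.val '' G.1 ⊆ (π G).1.1)

theorem faceMap_mk (v : V) (x : F) :
    faceMap hπ (mk (inducedColoring F lam π) (Submodule.Quotient.mk v) x) = mk lam v x :=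
  mk_eq_mk_of_quotient x (Function.surjInv_eq (Submodule.mkQ_surjective _) _)

theorem exists_eq_mk_quotient (p : RealToric m F (inducedColoring F lam π)) :
    ∃ (v : V) (x : F), p = mk (inducedColoring F lam π) (Submodule.Quotient.mk v) x := by
  obtain ⟨w, x, rfl⟩ := exists_eq_mk p
  obtain ⟨v, rfl⟩ := Submodule.mkQ_surjective _ w
  exact ⟨v, x, rfl⟩

theorem proj_faceMap (p : RealToric m F (inducedColoring F lam π)) :
    proj (faceMap (lam := lam) hπ p) ∈ F := by
  obtain ⟨v, x, rfl⟩ := exists_eq_mk_quotient p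
  rw [faceMap_mk]
  exact x.2

theorem continuous_faceMap : Continuous (faceMap (lam := lam) hπ) := by
  refine continuous_def.2 fun A hA => isOpen_iff.2 fun w => ?_
  obtain ⟨v, rfl⟩ := Submodule.mkQ_surjective _ w
  have : mk (inducedColoring F lam π) ((Submodule.mkQ _) v) ⁻¹' (faceMap hπ ⁻¹' A) =
      Subtype.val ⁻¹' (mk lam v ⁻¹' A) := by
    ext x
    exact iff_of_eq (congrArg (· ∈ A) (faceMap_mk hπ v x))
  rw [this]
  exact (hA.preimage (continuous_mk v)).preimage continuous_subtype_val

/-- By injectivity, the trace of the image on the copy `v` is exactly the trace of `A` on the copy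
`v̄`, which is closed in `F` and hence in `X`. -/
theorem isClosed_image_faceMap (hF : IsClosed F)
    {A : Set (RealToric m F (inducedColoring F lam π))} (hA : IsClosed A)
    (hinj : Function.Injective (faceMap (lam := lam) hπ)) : IsClosed (faceMap hπ '' A) := by
  refine isClosed_iff.2 fun v => ?_
  have : mk lam v ⁻¹' (faceMap hπ '' A) = Subtype.val ''
      (mk (inducedColoring F lam π) (Submodule.Quotient.mk v) ⁻¹' A) := by
    ext x
    constructor
    · rintro ⟨p, hp, hpx⟩
      have hx : x ∈ F := by
        have := proj_faceMap hπ p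
        rwa [hpx] at this
      refine ⟨⟨x, hx⟩, ?_, rfl⟩
      rw [← faceMap_mk hπ v ⟨x, hx⟩] at hpx
      rw [mem_preimage, ← hinj hpx]
      exact hp
    · rintro ⟨y, hy, rfl⟩
      exact ⟨_, hy, faceMap_mk hπ v y⟩
  rw [this]
  exact hF.isClosedEmbedding_subtypeVal.isClosedMap _ (hA.preimage (continuous_mk _))

theorem hasChain_faceMap {p q : RealToric m F (inducedColoring F lam π)} {l : ℝ≥0∞}
    (h : HasChain p q l) : HasChain (faceMap hπ p) (faceMap hπ q) l := by
  induction h with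
  | refl => exact HasChain.refl
  | step v x y l _ ih => exact HasChain.step _ (x : X) y l ih

theorem glueDist_faceMap_le (p q : RealToric m F (inducedColoring F lam π)) :
    glueDist (faceMap hπ p) (faceMap hπ q) ≤ glueDist p q :=
  le_sInf fun _ hl => (hasChain_faceMap hπ hl).glueDist_le

/-! ### Identifications and distances over the face -/

variable (hmk : m + k = n) (hX : IsRightAngledManifold n X) (hemb : EmbeddedFacets n X)
  (hF : IsFace n k F)

include hπ hmk hX hemb hF

/-- A facet of `X` through `x` either contains `F`, and its color dies in the quotient, or contains
a facet of `F` through `x`, whose induced color is the class of its own. -/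
theorem IsFace.mk_eq_mk_iff {v w : V} {x : F} :
    mk (inducedColoring F lam π) (Submodule.Quotient.mk v) x =
      mk (inducedColoring F lam π) (Submodule.Quotient.mk w) x ↔ mk lam v x = mk lam w x := by
  refine ⟨fun h => ?_, fun h => ?_⟩
  · rw [← faceMap_mk hπ, ← faceMap_mk hπ, h]
  · rw [RealToric.mk_eq_mk_iff] at h ⊢
    refine ⟨rfl, ?_⟩
    have hsub : lam '' {G | (x : X) ∈ G.1} ⊆
        lam '' supp n F ∪ (fun G => lam (π G).1) '' {G : Facet m F | x ∈ G.1} := by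
      rintro _ ⟨H, hH, rfl⟩
      by_cases hFH : F ⊆ H.1
      · exact Or.inl ⟨H, hFH, rfl⟩
      · obtain ⟨G, hxG, hGH⟩ := hF.exists_facet_subset hmk hX hemb x H.2 hFH hH
        refine Or.inr ⟨G, hxG, ?_⟩
        have hadj : H ∈ adj n m F := (hF.mem_adj_iff hmk hX hemb).2 ⟨⟨x, x.2, hH⟩, hFH⟩
        have := (hF.existsUnique_adj hmk hX hemb G).unique (y₁ := π G) (y₂ := ⟨H, hadj⟩)
          (hπ G) hGH
        simp only [this]
    have h1 := Submodule.mem_map_of_mem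
      (f := (Submodule.span (ZMod 2) (lam '' supp n F)).mkQ) (Submodule.span_mono hsub h.2)
    rw [Submodule.span_union, Submodule.map_sup, Submodule.mkQ_map_self, bot_sup_eq,
      Submodule.map_span, image_image] at h1
    exact h1

theorem IsFace.faceMap_injective : Function.Injective (faceMap (lam := lam) hπ) := by
  intro p q hpq
  obtain ⟨v, x, rfl⟩ := exists_eq_mk_quotient p
  obtain ⟨w, y, rfl⟩ := exists_eq_mk_quotient q
  rw [faceMap_mk, faceMap_mk] at hpq
  obtain rfl : x = y := Subtype.ext (RealToric.mk_eq_mk_iff.1 hpq).1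
  exact (hF.mk_eq_mk_iff hπ hmk hX hemb).2 hpq

omit hπ hmk in
/-- Near each point, the manifold retracts to the face without increasing distances. -/
theorem IsFace.exists_retraction (x : F) : ∃ r > 0, ∃ R : X → F,
    (∀ y z, dist y (x : X) < r → dist z (x : X) < r → dist (R y) (R z) ≤ dist y z) ∧
    (∀ y : F, dist y x < r → R y = y) ∧
    ∀ y, dist y (x : X) < r → ∀ G, IsFace n 1 G → y ∈ G → (R y : X) ∈ G ∧ (x : X) ∈ G := by
  classical
  obtain ⟨N, φ, ε, g, S, h⟩ := hF.exists_isFaceBox hX hemb x.2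
  let T := S.toFinset
  have hT (y) (hy : y ∈ N) (hyF : y ∈ F) : orthProj T (φ y) = φ y :=
    orthProj_eq_self fun i hi => (h.mem_face_iff y hy).1 hyF (mem_toFinset.1 hi)
  have hlim : Filter.Tendsto (fun y => orthProj T (φ y)) (𝓝 (x : X)) (𝓝 (φ x)) := by
    have := ((continuous_orthProj T).tendsto (φ x)).comp (h.continuousAt h.mem)
    rwa [hT x h.mem x.2] at this
  obtain ⟨r, hr, hball⟩ := Metric.eventually_nhds_iff.1
    ((h.isOpen.eventually_mem h.mem).and (hlim.eventually (h.eventually_exists h.mem Filter.univ_mem)))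
  have hex (y : X) : ∃ z : F, dist y x < r → (z : X) ∈ N ∧ φ z = orthProj T (φ y) := by
    by_cases hy : dist y x < r
    · obtain ⟨hyN, hyz⟩ := hball hy
      obtain ⟨z, hz, hzy⟩ := hyz (orthProj_nonneg fun i => h.nonneg hyN i)
      have hzF : z ∈ F := (h.mem_face_iff z hz.1).2 fun i hi => by
        rw [mem_zeroSet, hzy, orthProj_apply_of_mem (mem_toFinset.2 hi)]
      exact ⟨⟨z, hzF⟩, fun _ => ⟨hz.1, hzy⟩⟩
    -- Outside the ball the value of the retraction is irrelevant; `x` is a default.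
    · exact ⟨x, fun h => absurd h hy⟩
  choose R hR using hex
  refine ⟨r, hr, R, fun y z hy hz => ?_, fun y hy => ?_, fun y hy G hG hyG => ?_⟩
  · rw [Subtype.dist_eq, h.isometry _ (hR y hy).1 _ (hR z hz).1, (hR y hy).2, (hR z hz).2,
      h.isometry _ (hball hy).1 _ (hball hz).1]
    exact hypDist_orthProj_le _ _ _
  · refine Subtype.ext (h.toIsCornerChart.injOn (hR y hy).1 (hball hy).1 ?_)
    rw [(hR y hy).2, hT y (hball hy).1 y.2]
  · obtain ⟨i, hi, rfl⟩ := (h.mem_iff y (hball hy).1 G hG).1 hyG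
    refine ⟨(h.mem_iff _ (hR y hy).1 _ hG).2 ⟨i, ?_, rfl⟩,
      (h.mem_iff _ h.mem _ hG).2 ⟨i, h.zeroSet_subset (hball hy).1 hi, rfl⟩⟩
    rw [(hR y hy).2]
    -- The projection keeps vanishing coordinates zero, so points do not leave their facets and the
    -- gluings survive.
    exact zeroSet_subset_orthProj T _ hi

/-- A short chain between points near `p` stays over the ball where the retraction is defined, and
is pushed into the face. A long chain is beaten by the detour through the center `x`. -/
theorem IsFace.exists_glueDist_eq (p : RealToric m F (inducedColoring F lam π)) :
    ∃ U ∈ 𝓝 p, ∀ q ∈ U, ∀ q' ∈ U,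
      glueDist (faceMap (lam := lam) hπ q) (faceMap hπ q') = glueDist q q' := by
  obtain ⟨v₀, x, rfl⟩ := exists_eq_mk_quotient p
  obtain ⟨r, hr, R, hRd, hRF, hRG⟩ := hF.exists_retraction hX hemb x
  have hiff {v w : V} {y : F} := hF.mk_eq_mk_iff (lam := lam) (v := v) (w := w) (x := y)
    hπ hmk hX hemb
  set M := mk (inducedColoring F lam π) with hM
  -- The part over the ball of radius `r / 3` of all copies glued to `v₀` at the center.
  let U : Set (RealToric m F (inducedColoring F lam π)) := {q | ∃ (v : V) (y : F),
    q = M (Submodule.Quotient.mk v) y ∧ dist y x < r / 3 ∧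
      M (Submodule.Quotient.mk v) x = M (Submodule.Quotient.mk v₀) x}
  have hU : IsOpen U := by
    refine isOpen_iff.2 fun w => ?_
    obtain ⟨w, rfl⟩ := Submodule.mkQ_surjective _ w
    have : M ((Submodule.mkQ _) w) ⁻¹' U = {y | dist y x < r / 3 ∧
        M ((Submodule.mkQ _) w) x = M (Submodule.Quotient.mk v₀) x} := by
      ext y
      constructor
      · rintro ⟨v, z, hyz, hz, hv⟩
        obtain rfl : y = z := (RealToric.mk_eq_mk_iff.1 hyz).1
        refine ⟨hz, Eq.trans ?_ hv⟩
        -- Facets through a point near `x` also pass through `x`, so two copies glued at `y` are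
        -- glued at the center; the condition on the copy is thus independent of the representative.
        exact hiff.2 (mk_eq_mk_of_facets (fun G hG hyG =>
          (hRG y (lt_trans hz (by linarith)) G hG hyG).2) (hiff.1 hyz))
      · exact fun hy => ⟨w, y, rfl, hy⟩
    rw [this]
    exact (isOpen_lt (by fun_prop) continuous_const).and isOpen_const
  refine ⟨U, hU.mem_nhds ⟨v₀, x, rfl, by simpa using hr, rfl⟩, ?_⟩
  rintro _ ⟨v, y, rfl, hy, hv⟩ _ ⟨w, z, rfl, hz, hw⟩
  refine le_antisymm (glueDist_faceMap_le hπ _ _) (le_sInf fun l hl => ?_)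
  rw [hM, faceMap_mk, faceMap_mk] at hl
  -- A chain shorter than `2r/3` from a point within `r/3` of `x` stays within `r`; the detour
  -- through `x` has length at most `2r/3`.
  rcases lt_or_ge l (ENNReal.ofReal (2 * r / 3)) with hlr | hlr
  · have hnear (u : X) (hu : edist (y : X) u < ENNReal.ofReal (2 * r / 3)) : dist u x < r := by
      rw [edist_dist, ENNReal.ofReal_lt_ofReal_iff (by positivity)] at hu
      have h1 := dist_triangle_left u x y
      have h2 : dist (y : X) x < r / 3 := hy
      linarith
    -- Quantifying over all representatives of the endpoint handles changes of copy along the chain: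
    -- a gluing valid at `u` remains valid at `R u`.
    have key : ∀ (q : RealToric n X lam) (l : ℝ≥0∞), HasChain (mk lam v (y : X)) q l →
        l < ENNReal.ofReal (2 * r / 3) → ∀ w u, q = mk lam w u → edist (y : X) u ≤ l ∧
          ∃ l' ≤ l, HasChain (M (Submodule.Quotient.mk v) y)
            (M (Submodule.Quotient.mk w) (R u)) l' := by
      intro q l hq
      induction hq with
      | refl =>
        intro _ w u hu
        obtain rfl := (RealToric.mk_eq_mk_iff.1 hu).1
        refine ⟨by simp, 0, le_rfl, ?_⟩
        rw [hRF y (lt_trans hy (by linarith)), ← hiff.2 hu]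
        exact HasChain.refl
      | step v₁ a b l _ ih =>
        intro hlt w u hu
        obtain rfl := (RealToric.mk_eq_mk_iff.1 hu).1
        have hll := le_self_add.trans_lt hlt
        obtain ⟨hya, l₁, hl₁, hc⟩ := ih hll v₁ a rfl
        have hyb : edist (y : X) b ≤ l + edist a b :=
          (edist_triangle _ a _).trans (by gcongr)
        have ha := hnear a (hya.trans_lt hll)
        have hb := hnear b (hyb.trans_lt hlt)
        refine ⟨hyb, l₁ + edist (R a) (R b), ?_, ?_⟩
        · refine add_le_add hl₁ ?_
          rw [edist_dist, edist_dist]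
          exact ENNReal.ofReal_le_ofReal (hRd a b ha hb)
        · rw [← hiff.2 (mk_eq_mk_of_facets (fun G hG hbG => (hRG b hb G hG hbG).1) hu)]
          exact HasChain.step _ _ _ _ hc
    obtain ⟨-, l', hl', hc⟩ := key _ l hl hlr w z rfl
    rw [hRF z (lt_trans hz (by linarith))] at hc
    exact hc.glueDist_le.trans hl'
  · have h1 : HasChain (M (Submodule.Quotient.mk v) y) (M (Submodule.Quotient.mk w) z)
        (0 + edist y x + edist x z) := by
      refine HasChain.step _ _ _ _ ?_
      have := HasChain.step (p := M (Submodule.Quotient.mk v) y) (Submodule.Quotient.mk v) y x 0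
        HasChain.refl
      rw [← hM, hw, ← hv]
      exact this
    refine h1.glueDist_le.trans (le_trans ?_ hlr)
    rw [zero_add, edist_dist, edist_dist, ← ENNReal.ofReal_add dist_nonneg dist_nonneg]
    refine ENNReal.ofReal_le_ofReal ?_
    rw [dist_comm] at hz
    linarith

/-- `M(F, lam_F)` is the preimage of `F` in `M(X, lam)`. -/
noncomputable def IsFace.homeomorph : RealToric m F (inducedColoring F lam π) ≃ₜ
    ((proj : RealToric n X lam → X) ⁻¹' F) :=
  (Equiv.ofBijective (fun p => ⟨faceMap hπ p, proj_faceMap hπ p⟩)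
    ⟨fun p q hpq => hF.faceMap_injective hπ hmk hX hemb (congrArg Subtype.val hpq), by
      rintro ⟨q, hq⟩
      obtain ⟨v, x, rfl⟩ := exists_eq_mk q
      exact ⟨mk _ (Submodule.Quotient.mk v) ⟨x, hq⟩, Subtype.ext (faceMap_mk hπ v ⟨x, hq⟩)⟩⟩
    ).toHomeomorphOfContinuousClosed ((continuous_faceMap hπ).subtype_mk _) fun A hA => by
      refine isClosed_induced_iff.2 ⟨_, isClosed_image_faceMap hπ hF.isClosed hA
        (hF.faceMap_injective hπ hmk hX hemb), ?_⟩
      ext q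
      constructor
      · rintro ⟨p, hp, hpq⟩
        exact ⟨p, hp, Subtype.ext hpq⟩
      · rintro ⟨p, hp, rfl⟩
        exact ⟨p, hp, rfl⟩

end FaceToric

end RightAngled

theorem mainTheorem9 {n m k : ℕ} (hmk : m + k = n)
    {P : Type*} [MetricSpace P]
    (hP : RightAngled.IsRightAngledManifold n P) (hemb : RightAngled.EmbeddedFacets n P)
    {V : Type*} [AddCommGroup V] [Module (ZMod 2) V] [Module.Finite (ZMod 2) V]
    (lam : RightAngled.Facet n P → V) (hlam : RightAngled.IsColoring n P lam)
    (F : Set P) (hF : RightAngled.IsFace n k F) :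
    -- the face `F` is itself a right-angled hyperbolic manifold with embedded facets
    RightAngled.IsRightAngledManifold m F ∧ RightAngled.EmbeddedFacets m F ∧
    -- the natural map `Fac(F) → adj(F)`, sending `G` to the only `H ∈ adj(F)` containing it, is
    -- well defined and surjective
    ∃ π : RightAngled.Facet m F → RightAngled.adj n m F,
      (∀ (G : RightAngled.Facet m F) (H : RightAngled.adj n m F),
        Subtype.val '' G.1 ⊆ H.1.1 ↔ H = π G) ∧
      Function.Surjective π ∧
      RightAngled.IsColoring m F (RightAngled.inducedColoring F lam π) ∧
      -- the preimage of `F` in `M(P, lam)` is `M(F, lam_F)`, through `[v̄, x] ↦ [v, x]`, as a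
      -- topological space and as a hyperbolic manifold
      ∃ Φ : RightAngled.RealToric m F (RightAngled.inducedColoring F lam π) ≃ₜ
          ((RightAngled.RealToric.proj : RightAngled.RealToric n P lam → P) ⁻¹' F),
        (∀ (v : V) (x : F),
          (Φ (RightAngled.RealToric.mk _ (Submodule.Quotient.mk v) x) :
              RightAngled.RealToric n P lam) =
            RightAngled.RealToric.mk lam v x) ∧
        ∀ p, ∃ U ∈ 𝓝 p, ∀ q ∈ U, ∀ q' ∈ U,
          RightAngled.RealToric.glueDist (Φ q : RightAngled.RealToric n P lam)
              (Φ q' : RightAngled.RealToric n P lam) =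
            RightAngled.RealToric.glueDist q q' := by
  have hπ := fun G => (hF.existsUnique_adj hmk hP hemb G).choose_spec
  let π : RightAngled.Facet m F → RightAngled.adj n m F :=
    fun G => (hF.existsUnique_adj hmk hP hemb G).choose
  have hsub : ∀ G, Subtype.val '' G.1 ⊆ (π G).1.1 := fun G => (hπ G).1
  refine ⟨hF.isRightAngledManifold hmk hP hemb, hF.embeddedFacets hmk hP hemb, π,
    fun G H => ⟨fun h => (hπ G).2 H h, fun h => h ▸ hsub G⟩, fun H => ?_,
    hF.isColoring hmk hP hemb hlam hsub, hF.homeomorph hsub hmk hP hemb,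
    fun v x => RightAngled.faceMap_mk hsub v x, hF.exists_glueDist_eq hsub hmk hP hemb⟩
  obtain ⟨⟨x, hxF, hxH⟩, hFH⟩ := (hF.mem_adj_iff hmk hP hemb).1 H.2
  obtain ⟨G, -, hG⟩ := hF.exists_facet_subset hmk hP hemb ⟨x, hxF⟩ H.1.2 hFH hxH
  exact ⟨G, ((hπ G).2 H hG).symm⟩
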